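/- **Conventions.** A superalgebra is a $\mathbb Z/2$-graded associative unital real algebra $A=A^0\oplus A^1$ that is commutative in the graded sense; morphisms are even unital algebra morphisms. A superspace is a functor from superalgebras to sets; $\underline{\mathrm{Spec}}(B)(A)=\mathrm{Hom}(B,A)$, $\mathbb A^{1|0}(A)=A^0$ and $\mathbb R^{0|1}(A)=A^1$. A smooth manifold $X$ is regarded as the superspace $A\mapsto \mathrm{Hom}(\mathcal C^\infty(X),A)$, where $\mathcal C^\infty(X)$ is purely even. A commutative real algebra $B$ is *smoothly closed geometric* if for all $b_1,\dots,b_k\in B$ and $f\in\mathcal C^\infty(\mathbb R^k)$ there is a unique $b\in B$ with $f(x(b_1),\dots,x(b_k))=x(b)$ for all algebra morphisms $x:B\to\mathbb R$; a $B$-module $P$ is *geometric* if $\bigcap_{x}\ker(x)P=0$, the intersection being over all algebra morphisms $x:B\to\mathbb R$. A superalgebra $A$ is *smoothly closed geometric* if its heart $|A|=A/(A^1)$ (the quotient by the ideal generated by $A^1$) is smoothly closed geometric and $A^1$ is a geometric module over $|A|$, for some real $|A|$-module structure on $A^1$ in which every element of $|A|$ acts as multiplication by one of its representatives in $A^0$.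 Let $\mathrm{Alg}_{s,scg}$ be the full subcategory of such superalgebras. For a morphism of superspaces $\pi:C\to M$, the space of sections $\underline\Gamma(M,C)$ is the functor sending a superalgebra $A$ to the set of morphisms $s:M\times\underline{\mathrm{Spec}}(A)\to C\times\underline{\mathrm{Spec}}(A)$ with $(\pi\times\mathrm{id})\circ s=\mathrm{id}$. The space $\underline{\mathrm{Hom}}(\mathbb R^{0|1},X)$ is the functor $A\mapsto\mathrm{Hom}(\mathcal C^\infty(X),\mathbb R[\theta]\otimes A)$, with $\theta$ odd and $\theta^2=0$ and $\otimes$ the tensor product of superalgebras. **Proposition.** Let $X$ be a smooth manifold (Hausdorff, second countable, finite-dimensional, without boundary), and let $\pi: C=X\times\mathbb R^{0|1}\to\mathbb R^{0|1}=M$ be the projection. Let $\Omega^*(X)$ be the superalgebra of smooth differential forms, graded by the parity of the degree. There are natural isomorphisms of functors on $\mathrm{Alg}_{s,scg}$ $$\underline\Gamma(M,C)\;\cong\;\underline{\mathrm{Hom}}(\mathbb R^{0|1},X)\;\cong\;\underline{\mathrm{Spec}}(\Omega^*(X)).$$ The first sends a section $s$ over $\underline{\mathrm{Spec}}(A)$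 to the $X$-component of its value at the point $(\theta,\,A\to\mathbb R[\theta]\otimes A)$ of $M\times\underline{\mathrm{Spec}}(A)$. The second sends $f=f_0+\theta f_1$ to the morphism $F:\Omega^*(X)\to A$ with $F(g)=f_0(g)$ and $F(dg)=f_1(g)$ for all $g\in\mathcal C^\infty(X)$. Moreover, the real-valued functions on $\underline\Gamma(M,C)$, i.e. the morphisms $\underline\Gamma(M,C)\to\mathbb A^{1|0}$ of functors on $\mathrm{Alg}_{s,scg}$, are in bijection with the differential forms of even degree $\Omega^{2*}(X)$: the form $\alpha$ corresponds to the function $s\mapsto F_s(\alpha)$, where $F_s:\Omega^*(X)\to A$ is the morphism corresponding to $s$. -/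

import Mathlib

open CategoryTheory
open scoped Manifold ContDiff

universe u

noncomputable section

namespace Super

/-! ### Superalgebras -/

theorem zmod_two_cases : ∀ i : ZMod 2, i = 0 ∨ i = 1 := by decide

theorem one_add_one_zmod_two : (1 + 1 : ZMod 2) = 0 := by decide

/-- A `ℤ/2`-grading is the same as a pair of complementary submodules compatible with the
multiplication. -/
@[reducible] def gradedOfIsCompl {A : Type u} [Ring A] [Algebra ℝ A] (G : ZMod 2 → Submodule ℝ A)
    (hc : IsCompl (G 0) (G 1)) (h1 : (1 : A) ∈ G 0)
    (hm : ∀ i j (a b : A), a ∈ G i → b ∈ G j → a * b ∈ G (i + j)) : GradedAlgebra G :=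
  haveI : DirectSum.IsInternal G :=
    (DirectSum.isInternal_submodule_iff_isCompl G (i := 0) (j := 1) (by decide)
      (by ext i; fin_cases i; exacts [iff_of_true trivial (Or.inl rfl),
        iff_of_true trivial (Or.inr rfl)])).2 hc
  { one_mem := h1
    mul_mem := fun i j a b ha hb => hm i j a b ha hb
    toDecomposition := this.chooseDecomposition }

/-- A real superalgebra: an associative unital real algebra with a `ℤ/2`-grading
(`grading 0` the even part, `grading 1` the odd part) which is commutative in the graded sense,
i.e. a commutative monoid in the symmetric monoidal category of real super vector spaces. -/
structure SuperAlg : Type (u + 1) where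
  carrier : Type u
  [ring : Ring carrier]
  [algebra : Algebra ℝ carrier]
  grading : ZMod 2 → Submodule ℝ carrier
  [graded : GradedAlgebra grading]
  superComm : ∀ (i j : ZMod 2) (a b : carrier), a ∈ grading i → b ∈ grading j →
    a * b = (-1 : ℝ) ^ (i.val * j.val) • (b * a)

attribute [instance] SuperAlg.ring SuperAlg.algebra SuperAlg.graded

instance : CoeSort SuperAlg.{u} (Type u) := ⟨SuperAlg.carrier⟩

/-- A morphism of superalgebras: a unital algebra morphism that preserves the grading. -/
@[ext]
structure SuperAlg.Hom (A B : SuperAlg.{u}) where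
  toAlgHom : A →ₐ[ℝ] B
  map_mem : ∀ (i : ZMod 2) (a : A), a ∈ A.grading i → toAlgHom a ∈ B.grading i

instance : Category SuperAlg.{u} where
  Hom A B := SuperAlg.Hom A B
  id A := ⟨AlgHom.id ℝ A, fun _ _ h => h⟩
  comp f g := ⟨g.toAlgHom.comp f.toAlgHom, fun i a h => g.map_mem i _ (f.map_mem i a h)⟩

namespace SuperAlg

/-- The underlying algebra morphism of a morphism of superalgebras. -/
abbrev Hom.hom {A B : SuperAlg.{u}} (f : A ⟶ B) : A →ₐ[ℝ] B := SuperAlg.Hom.toAlgHom f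

variable (A : SuperAlg.{u})

/-- The even part `A⁰`. -/
abbrev even : Submodule ℝ A := A.grading 0

/-- The odd part `A¹`. -/
abbrev odd : Submodule ℝ A := A.grading 1

variable {A}

theorem even_comm {a : A} (ha : a ∈ A.even) (b : A) : a * b = b * a := by
  induction b using DirectSum.Decomposition.inductionOn A.grading with
  | zero => simp
  | homogeneous m => simpa using A.superComm 0 _ a m ha m.2
  | add m m' h h' => rw [mul_add, add_mul, h, h']

theorem odd_anticomm {a b : A} (ha : a ∈ A.odd) (hb : b ∈ A.odd) : a * b = -(b * a) := by
  simpa [ZMod.val_one] using A.superComm 1 1 a b ha hb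

theorem odd_mul_self {a : A} (ha : a ∈ A.odd) : a * a = 0 := by
  have h := odd_anticomm ha ha
  have h2 : (2 : ℝ) • (a * a) = 0 := by
    rw [two_smul]; nth_rewrite 1 [h]; simp
  exact (smul_eq_zero.1 h2).resolve_left two_ne_zero

variable (A)

/-- The parity involution `a ↦ ā`, equal to `1` on the even part and to `-1` on the odd part. -/
def parity : A →ₗ[ℝ] A :=
  GradedAlgebra.proj A.grading 0 - GradedAlgebra.proj A.grading 1

variable {A}

theorem parity_even {a : A} (ha : a ∈ A.even) : A.parity a = a := by
  simp [parity, GradedAlgebra.proj_apply, DirectSum.decompose_of_mem _ ha,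
    DirectSum.of_eq_of_ne]

theorem parity_odd {a : A} (ha : a ∈ A.odd) : A.parity a = -a := by
  simp [parity, GradedAlgebra.proj_apply, DirectSum.decompose_of_mem _ ha,
    DirectSum.of_eq_of_ne]

theorem exists_add (a : A) : ∃ b ∈ A.even, ∃ c ∈ A.odd, a = b + c := by
  induction a using DirectSum.Decomposition.inductionOn A.grading with
  | zero => exact ⟨0, zero_mem _, 0, zero_mem _, by simp⟩
  | @homogeneous i m =>
    fin_cases i
    · exact ⟨m, m.2, 0, zero_mem _, by simp⟩
    · exact ⟨0, zero_mem _, m, m.2, by simp⟩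
  | add m m' h h' =>
    obtain ⟨b, hb, c, hc, rfl⟩ := h
    obtain ⟨b', hb', c', hc', rfl⟩ := h'
    exact ⟨b + b', add_mem hb hb', c + c', add_mem hc hc', by abel⟩


theorem parity_mul (a b : A) : A.parity (a * b) = A.parity a * A.parity b := by
  obtain ⟨a, ha, a', ha', rfl⟩ := exists_add a
  obtain ⟨b, hb, b', hb', rfl⟩ := exists_add b
  have h00 : a * b ∈ A.even := by simpa using SetLike.mul_mem_graded ha hb
  have h01 : a * b' ∈ A.odd := by simpa using SetLike.mul_mem_graded ha hb'
  have h10 : a' * b ∈ A.odd := by simpa using SetLike.mul_mem_graded ha' hb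
  have h11 : a' * b' ∈ A.even := SetLike.mul_mem_graded ha' hb'
  simp only [add_mul, mul_add, map_add, parity_even h00, parity_even h11, parity_odd h01,
    parity_odd h10, parity_even ha, parity_even hb, parity_odd ha', parity_odd hb']
  noncomm_ring

theorem parity_parity (a : A) : A.parity (A.parity a) = a := by
  obtain ⟨a, ha, a', ha', rfl⟩ := exists_add a
  simp [parity_even ha, parity_odd ha']

theorem parity_one : A.parity 1 = 1 :=
  parity_even SetLike.GradedOne.one_mem

theorem parity_hom {A B : SuperAlg.{u}} (f : A ⟶ B) (a : A) :
    B.parity (Hom.hom f a) = Hom.hom f (A.parity a) := by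
  obtain ⟨a, ha, a', ha', rfl⟩ := exists_add a
  simp only [map_add, map_neg, parity_even ha, parity_odd ha', parity_even (Hom.map_mem f 0 a ha),
    parity_odd (Hom.map_mem f 1 a' ha')]

/-- A commutative algebra, seen as a superalgebra with zero odd part. -/
def ofCommAlg (R : Type u) [CommRing R] [Algebra ℝ R] : SuperAlg.{u} :=
  let G : ZMod 2 → Submodule ℝ R := fun i => if i = 0 then ⊤ else ⊥
  { carrier := R
    grading := G
    graded := gradedOfIsCompl G (by simpa [G] using isCompl_top_bot) (by simp [G]) (by
      intro i j a b ha hb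
      rcases zmod_two_cases i with rfl | rfl <;> rcases zmod_two_cases j with rfl | rfl <;>
        simp_all [G, one_add_one_zmod_two])
    superComm := by
      intro i j a b ha hb
      rcases zmod_two_cases i with rfl | rfl <;> rcases zmod_two_cases j with rfl | rfl <;>
        simp_all [G, mul_comm a b] }

/-! ### The superalgebra `ℝ[θ] ⊗ A` -/

/-- The underlying module of `ℝ[θ] ⊗ A`, with `θ` odd and `θ ^ 2 = 0`: the pair `(a, b)` is
`a + θ b`, that is `1 ⊗ a + θ ⊗ b`. -/
def ThetaExt (A : SuperAlg.{u}) : Type u := A × A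

namespace ThetaExt

instance : AddCommGroup (ThetaExt A) := inferInstanceAs (AddCommGroup (A × A))
instance : Module ℝ (ThetaExt A) := inferInstanceAs (Module ℝ (A × A))

/-- The component `a` of `a + θ b`. -/
def fst : ThetaExt A →ₗ[ℝ] A := LinearMap.fst ℝ A A

/-- The component `b` of `a + θ b`. -/
def snd : ThetaExt A →ₗ[ℝ] A := LinearMap.snd ℝ A A

/-- The element `a + θ b`. -/
def mk (a b : A) : ThetaExt A := (a, b)

@[simp] theorem fst_mk (a b : A) : (mk a b).fst = a := rfl
@[simp] theorem snd_mk (a b : A) : (mk a b).snd = b := rfl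

@[ext] theorem ext {x y : ThetaExt A} (h : x.fst = y.fst) (h' : x.snd = y.snd) : x = y :=
  Prod.ext h h'

/-- Since `a θ = θ ā`, one has `(a + θ b) (c + θ d) = a c + θ (b c + ā d)`. -/
instance : Mul (ThetaExt A) :=
  ⟨fun x y => mk (x.fst * y.fst) (x.snd * y.fst + A.parity x.fst * y.snd)⟩

instance : One (ThetaExt A) := ⟨mk 1 0⟩

@[simp] theorem fst_mul (x y : ThetaExt A) : (x * y).fst = x.fst * y.fst := rfl
@[simp] theorem snd_mul (x y : ThetaExt A) :
    (x * y).snd = x.snd * y.fst + A.parity x.fst * y.snd := rfl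
@[simp] theorem fst_one : (1 : ThetaExt A).fst = 1 := rfl
@[simp] theorem snd_one : (1 : ThetaExt A).snd = 0 := rfl

instance : Ring (ThetaExt A) :=
  { (inferInstance : AddCommGroup (ThetaExt A)), (inferInstance : Mul (ThetaExt A)),
    (inferInstance : One (ThetaExt A)) with
    left_distrib := fun x y z => by
      ext <;> simp [mul_add]; abel
    right_distrib := fun x y z => by
      ext <;> simp [add_mul]; abel
    zero_mul := fun x => by ext <;> simp
    mul_zero := fun x => by ext <;> simp
    mul_assoc := fun x y z => by
      ext <;> simp [mul_assoc, add_mul, mul_add, parity_mul, add_assoc]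
    one_mul := fun x => by ext <;> simp [parity_one]
    mul_one := fun x => by ext <;> simp }

instance : Algebra ℝ (ThetaExt A) :=
  Algebra.ofModule (fun r x y => by ext <;> simp) (fun r x y => by ext <;> simp)

/-- `θ` is odd, so `a + θ b` is homogeneous of degree `i` when `a` has degree `i` and `b` has
degree `i + 1` modulo `2`. -/
def grading (A : SuperAlg.{u}) (i : ZMod 2) : Submodule ℝ (ThetaExt A) :=
  (A.grading i).comap fst ⊓ (A.grading (i + 1)).comap snd

theorem mem_grading {i : ZMod 2} {x : ThetaExt A} :
    x ∈ grading A i ↔ x.fst ∈ A.grading i ∧ x.snd ∈ A.grading (i + 1) := Iff.rfl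

end ThetaExt

theorem isCompl_even_odd (A : SuperAlg.{u}) : IsCompl A.even A.odd :=
  (DirectSum.isInternal_submodule_iff_isCompl A.grading (i := 0) (j := 1) (by decide)
    (by ext i; fin_cases i; exacts [iff_of_true trivial (Or.inl rfl),
      iff_of_true trivial (Or.inr rfl)])).1 (DirectSum.Decomposition.isInternal A.grading)

theorem parity_mem (i : ZMod 2) {a : A} (ha : a ∈ A.grading i) :
    A.parity a = (-1 : ℝ) ^ i.val • a := by
  rcases zmod_two_cases i with rfl | rfl
  · simpa using parity_even ha
  · simpa [ZMod.val_one] using parity_odd ha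

/-- The superalgebra `ℝ[θ] ⊗ A`. -/
def theta (A : SuperAlg.{u}) : SuperAlg.{u} where
  carrier := ThetaExt A
  grading := ThetaExt.grading A
  graded := gradedOfIsCompl _
    (by
      have h := isCompl_even_odd A
      refine ⟨Submodule.disjoint_def.2 fun x h0 h1 => ?_, codisjoint_iff.2 (eq_top_iff.2 ?_)⟩
      · exact ThetaExt.ext (Submodule.disjoint_def.1 h.disjoint _ h0.1 h1.1)
          (Submodule.disjoint_def.1 h.disjoint _ h1.2 h0.2)
      · rintro x -
        obtain ⟨a, ha, a', ha', h1⟩ := exists_add x.fst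
        obtain ⟨b, hb, b', hb', h2⟩ := exists_add x.snd
        have : x = ThetaExt.mk a b' + ThetaExt.mk a' b :=
          ThetaExt.ext h1 (h2.trans (add_comm _ _))
        rw [this]
        exact Submodule.add_mem_sup ⟨ha, hb'⟩ ⟨ha', hb⟩)
    ⟨SetLike.GradedOne.one_mem (A := A.grading), zero_mem (A.grading (0 + 1))⟩
    (by
      rintro i j x y ⟨hx, hx'⟩ ⟨hy, hy'⟩
      refine ⟨SetLike.mul_mem_graded (A := A.grading) hx hy, ?_⟩
      change x.snd * y.fst + A.parity x.fst * y.snd ∈ A.grading (i + j + 1)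
      refine add_mem ?_ ?_
      · have := SetLike.mul_mem_graded (A := A.grading) hx' hy
        rwa [add_right_comm] at this
      · rw [parity_mem i hx, add_assoc]
        exact SetLike.mul_mem_graded (A := A.grading) ((A.grading i).smul_mem _ hx) hy')
  superComm := by
    rintro i j x y ⟨hx, hx'⟩ ⟨hy, hy'⟩
    refine ThetaExt.ext (A.superComm i j _ _ hx hy) ?_
    change x.snd * y.fst + A.parity x.fst * y.snd =
      (-1 : ℝ) ^ (i.val * j.val) • (y.snd * x.fst + A.parity y.fst * x.snd)
    rw [parity_mem i hx, parity_mem j hy, A.superComm _ _ _ _ hx' hy, smul_mul_assoc,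
      A.superComm _ _ _ _ hx hy']
    rcases zmod_two_cases i with rfl | rfl <;> rcases zmod_two_cases j with rfl | rfl <;>
      simp [ZMod.val_one, one_add_one_zmod_two, add_comm]

@[simp] theorem fst_algebraMap (r : ℝ) :
    ThetaExt.fst (algebraMap ℝ (ThetaExt A) r) = algebraMap ℝ A r := by
  rw [Algebra.algebraMap_eq_smul_one, Algebra.algebraMap_eq_smul_one]; simp

@[simp] theorem snd_algebraMap (r : ℝ) :
    ThetaExt.snd (algebraMap ℝ (ThetaExt A) r) = 0 := by
  rw [Algebra.algebraMap_eq_smul_one]; simp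

/-- The morphism `ℝ[θ] ⊗ A ⟶ ℝ[θ] ⊗ B` induced by `f : A ⟶ B`. -/
def thetaMap {A B : SuperAlg.{u}} (f : A ⟶ B) : theta A ⟶ theta B where
  toAlgHom :=
    { toFun := fun x : ThetaExt A => ThetaExt.mk (Hom.hom f x.fst) (Hom.hom f x.snd)
      map_one' := ThetaExt.ext (map_one (Hom.hom f)) (map_zero (Hom.hom f))
      map_mul' := fun x y => ThetaExt.ext (map_mul (Hom.hom f) x.fst y.fst) (by
        change Hom.hom f (x.snd * y.fst + A.parity x.fst * y.snd) =
          Hom.hom f x.snd * Hom.hom f y.fst + B.parity (Hom.hom f x.fst) * Hom.hom f y.snd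
        rw [map_add, map_mul, map_mul, parity_hom])
      map_zero' := ThetaExt.ext (map_zero (Hom.hom f)) (map_zero (Hom.hom f))
      map_add' := fun x y => ThetaExt.ext (map_add (Hom.hom f) x.fst y.fst)
        (map_add (Hom.hom f) x.snd y.snd)
      commutes' := fun r => ThetaExt.ext
        (by change Hom.hom f (ThetaExt.fst (algebraMap ℝ (ThetaExt A) r)) =
              ThetaExt.fst (algebraMap ℝ (ThetaExt B) r)
            rw [fst_algebraMap, fst_algebraMap, AlgHom.commutes])
        (by change Hom.hom f (ThetaExt.snd (algebraMap ℝ (ThetaExt A) r)) =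
              ThetaExt.snd (algebraMap ℝ (ThetaExt B) r)
            rw [snd_algebraMap, snd_algebraMap, map_zero]) }
  map_mem := fun i _ hx => ⟨Hom.map_mem f i _ hx.1, Hom.map_mem f (i + 1) _ hx.2⟩

/-- The functor `A ↦ ℝ[θ] ⊗ A`. -/
def thetaFunctor : SuperAlg.{u} ⥤ SuperAlg.{u} where
  obj := theta
  map := thetaMap
  map_id _ := rfl
  map_comp _ _ := rfl

/-- The inclusion `A ⟶ ℝ[θ] ⊗ A`, `a ↦ 1 ⊗ a`. -/
def thetaIncl (A : SuperAlg.{u}) : A ⟶ theta A where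
  toAlgHom :=
    { toFun := fun a => ThetaExt.mk a 0
      map_one' := rfl
      map_mul' := fun a b => ThetaExt.ext rfl (by
        change (0 : A) = 0 * b + A.parity a * 0
        simp)
      map_zero' := rfl
      map_add' := fun a b => ThetaExt.ext rfl (by
        change (0 : A) = 0 + 0
        simp)
      commutes' := fun r => ThetaExt.ext (fst_algebraMap r).symm (snd_algebraMap r).symm }
  map_mem := fun i _ ha => ⟨ha, zero_mem (A.grading (i + 1))⟩

/-- The odd element `θ = θ ⊗ 1` of `ℝ[θ] ⊗ A`. -/
def thetaVar (A : SuperAlg.{u}) : (theta A).odd :=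
  ⟨ThetaExt.mk 0 1, zero_mem (A.grading 1),
    (one_add_one_zmod_two ▸ SetLike.GradedOne.one_mem (A := A.grading) : (1 : A) ∈ A.grading (1 + 1))⟩

end SuperAlg

/-! ### Smoothly closed geometric superalgebras -/

/-- A real algebra `B`, with set of real points `Spec_ℝ B = Hom(B, ℝ)`, is smoothly closed
geometric if for all `a₁, …, aₙ ∈ B` and `f ∈ C^∞(ℝⁿ)` there is a unique `b ∈ B` such that
`f ∘ (ev_{a₁} × ⋯ × ev_{aₙ}) = ev_b` on `Spec_ℝ B`. -/
def IsSmoothlyClosedGeometric (B : Type u) [CommRing B] [Algebra ℝ B] : Prop :=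
  ∀ (n : ℕ) (a : Fin n → B) (f : (Fin n → ℝ) → ℝ), ContDiff ℝ ∞ f →
    ∃! b : B, ∀ x : B →ₐ[ℝ] ℝ, f (fun i => x (a i)) = x b

/-- A module `P` over a real algebra `B` is geometric if the intersection of the submodules
`𝔪_x P` over all real points `x` of `B` is zero. -/
def IsGeometricModule (B : Type u) [CommRing B] [Algebra ℝ B]
    (P : Type u) [AddCommGroup P] [Module B P] : Prop :=
  ⨅ x : B →ₐ[ℝ] ℝ, RingHom.ker x • (⊤ : Submodule B P) = ⊥

namespace SuperAlg

/-- The ideal of `A` generated by the odd part. -/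
def oddIdeal (A : SuperAlg.{u}) : Ideal A := Ideal.span (A.odd : Set A)

instance (A : SuperAlg.{u}) : (oddIdeal A).IsTwoSided := by
  refine ⟨fun {a} b ha => ?_⟩
  induction ha using Submodule.span_induction with
  | mem x hx =>
    obtain ⟨c, hc, d, hd, rfl⟩ := exists_add b
    rw [mul_add, ← even_comm hc x, odd_anticomm hx hd]
    exact add_mem (Ideal.mul_mem_left _ _ (Ideal.subset_span hx))
      (neg_mem (Ideal.mul_mem_left _ _ (Ideal.subset_span hx)))
  | zero => simp
  | add x y _ _ hx hy => rw [add_mul]; exact add_mem hx hy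
  | smul c x _ hx => rw [smul_eq_mul, mul_assoc]; exact Ideal.mul_mem_left _ _ hx

/-- The heart `|A|`: the quotient of `A` by the ideal generated by the odd part. -/
abbrev Heart (A : SuperAlg.{u}) : Type u := A ⧸ oddIdeal A

instance (A : SuperAlg.{u}) : CommRing (Heart A) :=
  { (inferInstance : Ring (Heart A)) with
    mul_comm := by
      intro x y
      obtain ⟨a, rfl⟩ := Ideal.Quotient.mk_surjective x
      obtain ⟨b, rfl⟩ := Ideal.Quotient.mk_surjective y
      obtain ⟨a, ha, a', ha', rfl⟩ := exists_add a
      have h : Ideal.Quotient.mk (oddIdeal A) a' = 0 :=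
        Ideal.Quotient.eq_zero_iff_mem.2 (Ideal.subset_span ha')
      rw [map_add, h, add_zero, ← map_mul, ← map_mul, even_comm ha b] }

/-- A superalgebra `A` is smoothly closed geometric if its heart `|A|` is smoothly closed
geometric and its odd part `A¹` is a geometric module over `|A|`. Here the multiplication of `A`
makes `A¹` a module over `A⁰`, and an `|A|`-module structure on `A¹` is understood to be induced
by it: each element of `|A|` acts on `A¹` as multiplication by some even representative in `A`.
If `A¹ A¹ A¹ = 0`, there is exactly one such structure; any splitting of `A⁰ → |A|` gives one. -/
def IsSCG (A : SuperAlg.{u}) : Prop :=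
  IsSmoothlyClosedGeometric (Heart A) ∧
    ∃ (_ : Module (Heart A) A.odd) (_ : IsScalarTower ℝ (Heart A) A.odd),
      (∀ b : Heart A, ∃ a ∈ A.even, Ideal.Quotient.mk (oddIdeal A) a = b ∧
        ∀ m : A.odd, ((b • m : A.odd) : A) = a * m) ∧
      IsGeometricModule (Heart A) A.odd

/-- The category of smoothly closed geometric superalgebras, a full subcategory of the category
of superalgebras. -/
abbrev SCG : Type (u + 1) := ObjectProperty.FullSubcategory (fun A : SuperAlg.{u} => IsSCG A)

/-- The inclusion of smoothly closed geometric superalgebras into superalgebras. -/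
abbrev incl : SCG.{u} ⥤ SuperAlg.{u} := ObjectProperty.ι _

end SuperAlg

open SuperAlg

/-! ### Superspaces as functors of points -/

/-- Superspaces, given by their points with values in superalgebras. -/
abbrev Space : Type (u + 1) := SuperAlg.{u} ⥤ Type u

/-- The affine superspace `Spec A`, with `Spec A (B) = Hom(A, B)`. -/
abbrev Spec (A : SuperAlg.{u}) : Space.{u} := coyoneda.obj (Opposite.op A)

/-- The morphism `Spec B ⟶ Spec A` induced by `f : A ⟶ B`. -/
abbrev specMap {A B : SuperAlg.{u}} (f : A ⟶ B) : Spec B ⟶ Spec A := coyoneda.map f.op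

/-- The product of two superspaces. -/
def prod (F G : Space.{u}) : Space.{u} where
  obj B := F.obj B × G.obj B
  map f := ↾fun p => (F.map f p.1, G.map f p.2)

/-- The point of a product with given components. -/
def pair {F G : Space.{u}} {B : SuperAlg.{u}} (a : F.obj B) (b : G.obj B) : (prod F G).obj B :=
  (a, b)

/-- The second projection. -/
def prodSnd (F G : Space.{u}) : prod F G ⟶ G where
  app B := ↾fun p => p.2

/-- The product `π × id_G` of a morphism with an identity. -/
def prodMapLeft {F F' : Space.{u}} (π : F ⟶ F') (G : Space.{u}) : prod F G ⟶ prod F' G where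
  app B := ↾fun p => (π.app B p.1, p.2)
  naturality B B' f := by
    ext p
    exact congrArg (fun a => ((a, G.map f p.2) : F'.obj B' × G.obj B'))
      (NatTrans.naturality_apply π f p.1)

/-- The affine superspace `𝔸^{1|0}`, `B ↦ B⁰`. -/
def affineEven : Space.{u} where
  obj B := B.even
  map f := ↾fun b => ⟨Hom.hom f b.1, Hom.map_mem f 0 b.1 b.2⟩

/-- The affine superspace `ℝ^{0|1} = 𝔸^{0|1}`, `B ↦ B¹`. -/
def affineOdd : Space.{u} where
  obj B := B.odd
  map f := ↾fun b => ⟨Hom.hom f b.1, Hom.map_mem f 1 b.1 b.2⟩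

/-- For `π : C ⟶ M`, the sections of `π × id : C × Spec A ⟶ M × Spec A` over `Spec A`. -/
def SectionsAt {C M : Space.{u}} (π : C ⟶ M) (A : SuperAlg.{u}) : Type (u + 1) :=
  {s : prod M (Spec A) ⟶ prod C (Spec A) // s ≫ prodMapLeft π (Spec A) = 𝟙 _}

theorem SectionsAt.app_snd {C M : Space.{u}} {π : C ⟶ M} {A : SuperAlg.{u}} (s : SectionsAt π A)
    (T : SuperAlg.{u}) (p : (prod M (Spec A)).obj T) : (s.1.app T p).2 = p.2 :=
  congrArg Prod.snd (ConcreteCategory.congr_hom (NatTrans.congr_app s.2 T) p)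

theorem SectionsAt.app_fst {C M : Space.{u}} {π : C ⟶ M} {A : SuperAlg.{u}} (s : SectionsAt π A)
    (T : SuperAlg.{u}) (m : M.obj T) (α : (Spec A).obj T) :
    π.app T (s.1.app T (pair (F := M) (G := Spec A) m α)).1 = m := by
  have h := ConcreteCategory.congr_hom (NatTrans.congr_app s.2 T)
    (pair (F := M) (G := Spec A) m α)
  have h' := congrArg Prod.fst h
  exact h'

/-- Base change of sections along `Spec B ⟶ Spec A`: the section `s` goes to
`(m, β) ↦ (c, β)`, where `c` is the `C`-component of `s (m, β ∘ f)`. -/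
def SectionsAt.baseChange {C M : Space.{u}} {π : C ⟶ M} {A B : SuperAlg.{u}} (f : A ⟶ B)
    (s : SectionsAt π A) : SectionsAt π B where
  val :=
    { app := fun T => ↾fun p => ((s.1.app T (pair (F := M) (G := Spec A) p.1 ((specMap f).app T p.2))).1, p.2)
      naturality := by
        intro T T' g
        ext p
        have h := NatTrans.naturality_apply s.1 g
          (pair (F := M) (G := Spec A) p.1 ((specMap f).app T p.2))
        have h' := congrArg Prod.fst h
        refine Prod.ext ?_ rfl
        refine Eq.trans ?_ h'
        rfl }
  property := by
    ext T p
    exact Prod.ext (s.app_fst T p.1 ((specMap f).app T p.2)) rfl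

/-- The space of sections `Γ(M, C)` of `π : C ⟶ M`, with
`Γ(M, C)(A) = Γ_{Spec A}(M × Spec A, C × Spec A)`. -/
def sectionSpace {C M : Space.{u}} (π : C ⟶ M) : SuperAlg.{u} ⥤ Type (u + 1) where
  obj A := SectionsAt π A
  map f := ↾SectionsAt.baseChange f
  map_id A := by
    ext s
    refine Subtype.ext ?_
    ext T p
    exact Prod.ext rfl (s.app_snd T p).symm
  map_comp f g := rfl

/-! ### Functions and differential forms on a manifold -/

section Manifold

variable (n : ℕ) (X : Type u) [TopologicalSpace X] [ChartedSpace (EuclideanSpace ℝ (Fin n)) X]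
  [IsManifold (𝓡 n) ∞ X]

/-- The algebra `C^∞(X)`, seen as a superalgebra with zero odd part. -/
def smoothFunctions : SuperAlg.{u} := SuperAlg.ofCommAlg C^∞⟮𝓡 n, X; 𝓘(ℝ, ℝ), ℝ⟯

/-- The manifold `X` as a superspace, `B ↦ Hom(C^∞(X), B)`. -/
abbrev manifoldSpace : Space.{u} := Spec (smoothFunctions n X)

/-- The projection `π : C = X × ℝ^{0|1} ⟶ ℝ^{0|1} = M`. -/
abbrev projection : prod (manifoldSpace n X) affineOdd ⟶ affineOdd := prodSnd _ _

/-- The superspace `Hom(ℝ^{0|1}, X)`, `A ↦ Hom(C^∞(X), ℝ[θ] ⊗ A)`. -/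
abbrev mappingSpace : Space.{u} := thetaFunctor ⋙ manifoldSpace n X

variable {X}

/-- The exterior algebra `Λ T*_x X` of the cotangent space at `x`. -/
abbrev FormsAt (x : X) : Type := ExteriorAlgebra ℝ (Module.Dual ℝ (TangentSpace (𝓡 n) x))

/-- A form at `y`, expressed in the coordinates on the tangent bundle around `x₀`. -/
def inCoord (x₀ y : X) :
    FormsAt n y →ₐ[ℝ] ExteriorAlgebra ℝ (Module.Dual ℝ (EuclideanSpace ℝ (Fin n))) :=
  ExteriorAlgebra.map
    ((trivializationAt (EuclideanSpace ℝ (Fin n)) (TangentSpace (𝓡 n)) x₀).symmL ℝ y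
      : EuclideanSpace ℝ (Fin n) →ₗ[ℝ] TangentSpace (𝓡 n) y).dualMap

/-- A form `α`, given by `α x ∈ Λ T*_x X`, is smooth if around every point `x₀` its coefficients
in the coordinates around `x₀` are smooth functions. -/
def IsSmoothForm (α : (x : X) → FormsAt n x) : Prop :=
  ∀ (x₀ : X) (l : Module.Dual ℝ
      (ExteriorAlgebra ℝ (Module.Dual ℝ (EuclideanSpace ℝ (Fin n))))),
    ContMDiffAt (𝓡 n) 𝓘(ℝ, ℝ) ∞ (fun y => l (inCoord n x₀ y (α y))) x₀

variable {n} in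
theorem IsSmoothForm.mul {α β : (x : X) → FormsAt n x} (hα : IsSmoothForm n α)
    (hβ : IsSmoothForm n β) : IsSmoothForm n (α * β) := by
  intro x₀ l
  let b := (Module.finBasis ℝ (Module.Dual ℝ (EuclideanSpace ℝ (Fin n)))).ExteriorAlgebra
  have h : (fun y => l (inCoord n x₀ y ((α * β) y))) = fun y => ∑ i, ∑ j,
      (b.coord i (inCoord n x₀ y (α y)) * b.coord j (inCoord n x₀ y (β y))) * l (b i * b j) := by
    funext y
    rw [Pi.mul_apply, map_mul]
    conv_lhs => rw [← b.sum_repr (inCoord n x₀ y (α y)), ← b.sum_repr (inCoord n x₀ y (β y))]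
    simp only [Finset.sum_mul_sum, map_sum, smul_mul_smul_comm, map_smul, smul_eq_mul,
      Module.Basis.coord_apply]
  rw [h]
  exact ContMDiffAt.sum fun i _ => ContMDiffAt.sum fun j _ =>
    ((hα x₀ _).mul (hβ x₀ _)).mul contMDiffAt_const

variable (X) in
/-- The algebra `Ω^*(X)` of differential forms: smooth sections of the bundle of exterior algebras
of the cotangent spaces, with the pointwise exterior product. -/
def formAlgebra : Subalgebra ℝ ((x : X) → FormsAt n x) where
  carrier := {α | IsSmoothForm n α}
  mul_mem' hα hβ := hα.mul hβ
  add_mem' {α β} hα hβ x₀ l := by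
    have h : (fun y => l (inCoord n x₀ y ((α + β) y))) =
        (fun y => l (inCoord n x₀ y (α y))) + fun y => l (inCoord n x₀ y (β y)) := by
      funext y
      simp only [Pi.add_apply, map_add]
    rw [h]
    exact (hα x₀ l).add (hβ x₀ l)
  algebraMap_mem' r x₀ l := by
    simpa only [Pi.algebraMap_apply, AlgHom.commutes] using contMDiffAt_const

section ExteriorAlgebra

variable {V : Type} [AddCommGroup V] [Module ℝ V]

open CliffordAlgebra in
theorem ext_ι_mul (v : V) (b : ExteriorAlgebra ℝ V) :
    ExteriorAlgebra.ι ℝ v * b = involute b * ExteriorAlgebra.ι ℝ v := by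
  induction b using ExteriorAlgebra.induction with
  | algebraMap r => simpa using (Algebra.commutes r _).symm
  | ι w =>
    have h : involute (Q := (0 : QuadraticForm ℝ V)) (ExteriorAlgebra.ι ℝ w)
      = -ExteriorAlgebra.ι ℝ w := involute_ι w
    rw [h, neg_mul]
    exact eq_neg_of_add_eq_zero_left (ExteriorAlgebra.ι_add_mul_swap v w)
  | mul a b ha hb => rw [map_mul, ← mul_assoc, ha, mul_assoc, hb, mul_assoc]
  | add a b ha hb => rw [map_add, mul_add, add_mul, ha, hb]

open CliffordAlgebra in
theorem ext_even_mul {a : ExteriorAlgebra ℝ V} (ha : a ∈ evenOdd (0 : QuadraticForm ℝ V) 0)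
    (b : ExteriorAlgebra ℝ V) : a * b = b * a := by
  induction a, ha using even_induction with
  | algebraMap r => exact Algebra.commutes r b
  | add x y _ _ hx hy => rw [add_mul, mul_add, hx, hy]
  | ι_mul_ι_mul v w x _ hx =>
    have hv := ext_ι_mul v
    have hw := ext_ι_mul w
    change ∀ b, CliffordAlgebra.ι (0 : QuadraticForm ℝ V) v * b =
      involute b * CliffordAlgebra.ι (0 : QuadraticForm ℝ V) v at hv
    change ∀ b, CliffordAlgebra.ι (0 : QuadraticForm ℝ V) w * b =
      involute b * CliffordAlgebra.ι (0 : QuadraticForm ℝ V) w at hw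
    rw [mul_assoc, hx, ← mul_assoc, mul_assoc (CliffordAlgebra.ι (0 : QuadraticForm ℝ V) v), hw,
      ← mul_assoc, hv, involute_involute]
    simp only [mul_assoc]

open CliffordAlgebra in
theorem ext_odd_mul {a : ExteriorAlgebra ℝ V} (ha : a ∈ evenOdd (0 : QuadraticForm ℝ V) 1)
    (b : ExteriorAlgebra ℝ V) : a * b = involute b * a := by
  induction a, ha using odd_induction with
  | ι v => exact ext_ι_mul v b
  | add x y _ _ hx hy => rw [add_mul, mul_add, hx, hy]
  | ι_mul_ι_mul v w x _ hx =>
    have hv := ext_ι_mul v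
    have hw := ext_ι_mul w
    change ∀ b, CliffordAlgebra.ι (0 : QuadraticForm ℝ V) v * b =
      involute b * CliffordAlgebra.ι (0 : QuadraticForm ℝ V) v at hv
    change ∀ b, CliffordAlgebra.ι (0 : QuadraticForm ℝ V) w * b =
      involute b * CliffordAlgebra.ι (0 : QuadraticForm ℝ V) w at hw
    rw [mul_assoc, hx, ← mul_assoc, mul_assoc (CliffordAlgebra.ι (0 : QuadraticForm ℝ V) v), hw,
      ← mul_assoc, hv, involute_involute]
    simp only [mul_assoc]

open CliffordAlgebra in
theorem ext_superComm (i j : ZMod 2) {a b : ExteriorAlgebra ℝ V}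
    (ha : a ∈ evenOdd (0 : QuadraticForm ℝ V) i) (hb : b ∈ evenOdd (0 : QuadraticForm ℝ V) j) :
    a * b = (-1 : ℝ) ^ (i.val * j.val) • (b * a) := by
  rcases zmod_two_cases i with rfl | rfl
  · simpa using ext_even_mul ha b
  · rw [ext_odd_mul ha b]
    rcases zmod_two_cases j with rfl | rfl
    · simp [involute_eq_of_mem_even hb]
    · simp [involute_eq_of_mem_odd hb, ZMod.val_one]

/-- The projection of an exterior algebra on its even part. -/
def extEvenPart (V : Type) [AddCommGroup V] [Module ℝ V] :
    ExteriorAlgebra ℝ V →ₗ[ℝ] ExteriorAlgebra ℝ V :=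
  (1 / 2 : ℝ) • (LinearMap.id + (CliffordAlgebra.involute (Q := (0 : QuadraticForm ℝ V))).toLinearMap)

open CliffordAlgebra in
theorem extEvenPart_mem (a : ExteriorAlgebra ℝ V) :
    extEvenPart V a ∈ evenOdd (0 : QuadraticForm ℝ V) 0 ∧
      a - extEvenPart V a ∈ evenOdd (0 : QuadraticForm ℝ V) 1 := by
  have h : a ∈ evenOdd (0 : QuadraticForm ℝ V) 0 ⊔ evenOdd (0 : QuadraticForm ℝ V) 1 :=
    (evenOdd_isCompl (0 : QuadraticForm ℝ V)).sup_eq_top ▸ Submodule.mem_top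
  obtain ⟨b, hb, c, hc, rfl⟩ := Submodule.mem_sup.1 h
  have : extEvenPart V (b + c) = b := by
    simp only [extEvenPart, LinearMap.smul_apply, LinearMap.add_apply, LinearMap.id_apply,
      AlgHom.toLinearMap_apply, map_add, involute_eq_of_mem_even hb, involute_eq_of_mem_odd hc]
    module
  rw [this]
  exact ⟨hb, by simpa using hc⟩

theorem map_extEvenPart {W : Type} [AddCommGroup W] [Module ℝ W] (f : V →ₗ[ℝ] W)
    (a : ExteriorAlgebra ℝ V) :
    ExteriorAlgebra.map f (extEvenPart V a) = extEvenPart W (ExteriorAlgebra.map f a) := by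
  have h : (ExteriorAlgebra.map f).comp (CliffordAlgebra.involute (Q := (0 : QuadraticForm ℝ V))) =
      (CliffordAlgebra.involute (Q := (0 : QuadraticForm ℝ W))).comp (ExteriorAlgebra.map f) := by
    apply ExteriorAlgebra.hom_ext
    ext v
    have h1 : CliffordAlgebra.involute (Q := (0 : QuadraticForm ℝ V)) (ExteriorAlgebra.ι ℝ v)
      = -ExteriorAlgebra.ι ℝ v := CliffordAlgebra.involute_ι v
    have h2 : CliffordAlgebra.involute (Q := (0 : QuadraticForm ℝ W)) (ExteriorAlgebra.ι ℝ (f v))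
      = -ExteriorAlgebra.ι ℝ (f v) := CliffordAlgebra.involute_ι _
    simp [h1, h2]
  have h' := DFunLike.congr_fun h a
  simp only [AlgHom.comp_apply] at h'
  simp [extEvenPart, h']

end ExteriorAlgebra

variable (X) in
/-- The superalgebra `Ω^*(X)` of differential forms, with the forms of even degree as even part
and the forms of odd degree as odd part. -/
def forms : SuperAlg.{u} :=
  let G : ZMod 2 → Submodule ℝ (formAlgebra n X) := fun i =>
    { carrier := {α | ∀ x : X, (α : (x : X) → FormsAt n x) x ∈
        CliffordAlgebra.evenOdd (0 : QuadraticForm ℝ (Module.Dual ℝ (TangentSpace (𝓡 n) x))) i}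
      add_mem' := fun ha hb x => add_mem (ha x) (hb x)
      zero_mem' := fun x => zero_mem _
      smul_mem' := fun r _ ha x => Submodule.smul_mem _ r (ha x) }
  { carrier := formAlgebra n X
    grading := G
    graded := gradedOfIsCompl G
      (by
        refine ⟨Submodule.disjoint_def.2 fun α h0 h1 => ?_, codisjoint_iff.2 (eq_top_iff.2 ?_)⟩
        · exact Subtype.ext (funext fun x =>
            Submodule.disjoint_def.1 (CliffordAlgebra.evenOdd_isCompl _).disjoint _ (h0 x) (h1 x))
        · rintro α -
          let β : formAlgebra n X := ⟨fun x => extEvenPart _ (α.1 x), fun x₀ l => by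
            have := α.2 x₀ (l.comp (extEvenPart _))
            simpa only [inCoord, map_extEvenPart, LinearMap.comp_apply] using this⟩
          have h : α = β + (α - β) := by abel
          rw [h]
          exact Submodule.add_mem_sup (fun x => (extEvenPart_mem (α.1 x)).1)
            (fun x => (extEvenPart_mem (α.1 x)).2))
      (fun x => SetLike.GradedOne.one_mem)
      (fun i j a b ha hb x => SetLike.mul_mem_graded (ha x) (hb x))
    superComm := fun i j a b ha hb =>
      Subtype.ext (funext fun x => ext_superComm i j (ha x) (hb x)) }

variable {n}

/-- A smooth function, as a differential form of degree `0`. -/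
def ofFunction (g : C^∞⟮𝓡 n, X; 𝓘(ℝ, ℝ), ℝ⟯) : forms n X :=
  (⟨fun x => algebraMap ℝ (FormsAt n x) (g x), fun x₀ l => by
    have h : (fun y => l (inCoord n x₀ y (algebraMap ℝ (FormsAt n y) (g y)))) =
        fun y => g y * l 1 := by
      funext y
      rw [AlgHom.commutes, Algebra.algebraMap_eq_smul_one, map_smul, smul_eq_mul]
    rw [h]
    exact g.contMDiff.contMDiffAt.mul contMDiffAt_const⟩ : formAlgebra n X)

/-- The differential `dg` of a smooth function, as a differential form of degree `1`. -/
def differential (g : C^∞⟮𝓡 n, X; 𝓘(ℝ, ℝ), ℝ⟯) : forms n X :=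
  (⟨fun x => ExteriorAlgebra.ι ℝ (mvfderiv (𝓡 n) g x : TangentSpace (𝓡 n) x →ₗ[ℝ] ℝ),
    fun x₀ l => by
      let L : (EuclideanSpace ℝ (Fin n) →L[ℝ] ℝ) →ₗ[ℝ] ℝ :=
        { toFun := fun φ => l (ExteriorAlgebra.ι ℝ (φ : EuclideanSpace ℝ (Fin n) →ₗ[ℝ] ℝ))
          map_add' := fun φ ψ => by simp
          map_smul' := fun r φ => by simp }
      have hg : ContMDiffAt (𝓡 n) 𝓘(ℝ, EuclideanSpace ℝ (Fin n) →L[ℝ] ℝ) ∞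
          (inTangentCoordinates (𝓡 n) 𝓘(ℝ, ℝ) id g (fun x => mfderiv (𝓡 n) 𝓘(ℝ, ℝ) g x) x₀) x₀ :=
        (g.contMDiff.contMDiffAt (x := x₀)).mfderiv_const (m := ∞) le_rfl
      have hL := L.toContinuousLinearMap.contMDiff.contMDiffAt.comp x₀ hg
      refine hL.congr_of_eventuallyEq (Filter.Eventually.of_forall fun y => ?_)
      change l (inCoord n x₀ y (ExteriorAlgebra.ι ℝ
        (mvfderiv (𝓡 n) g y : TangentSpace (𝓡 n) y →ₗ[ℝ] ℝ))) = l (ExteriorAlgebra.ι ℝ _)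
      rw [inCoord, ExteriorAlgebra.map_apply_ι]
      congr 2
      ext v
      simp only [inTangentCoordinates, ContinuousLinearMap.inCoordinates]
      erw [TangentBundle.continuousLinearMapAt_model_space]
      rfl⟩ : formAlgebra n X)

/-- The morphism `C^∞(X) ⟶ ℝ[θ] ⊗ A` given by a section `s` of `π × id` over `Spec A`: the
`X`-component of the value of `s` at the universal point `(θ, A ⟶ ℝ[θ] ⊗ A)` of
`ℝ^{0|1} × Spec A`. -/
def universalValue {A : SuperAlg.{u}} (s : SectionsAt (projection n X) A) :
    (mappingSpace n X).obj A :=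
  (s.1.app (theta A) (pair (F := affineOdd) (G := Spec A) (thetaVar A) (thetaIncl A))).1.1

/-- The first component `f₀` of a morphism `f = f₀ + θ f₁ : C^∞(X) ⟶ ℝ[θ] ⊗ A`. -/
def comp0 {A : SuperAlg.{u}} (f : (mappingSpace n X).obj A)
    (g : C^∞⟮𝓡 n, X; 𝓘(ℝ, ℝ), ℝ⟯) : A :=
  ThetaExt.fst (Hom.hom (A := smoothFunctions n X) (B := theta A) f g)

/-- The second component `f₁` of a morphism `f = f₀ + θ f₁ : C^∞(X) ⟶ ℝ[θ] ⊗ A`. -/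
def comp1 {A : SuperAlg.{u}} (f : (mappingSpace n X).obj A)
    (g : C^∞⟮𝓡 n, X; 𝓘(ℝ, ℝ), ℝ⟯) : A :=
  ThetaExt.snd (Hom.hom (A := smoothFunctions n X) (B := theta A) f g)

/-- The value at a form `α` of a point of `Spec Ω^*(X)` with values in `A`. -/
def evalForm {A : SuperAlg.{u}} (F : (Spec (forms n X)).obj A) (α : forms n X) : A :=
  Hom.hom (A := forms n X) (B := A) F α

end Manifold

end Super

end

/-!
A section over `Spec A` of the projection `X × ℝ^{0|1} ⟶ ℝ^{0|1}` is determined by its value at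
the universal point `(θ, A ⟶ ℝ[θ] ⊗ A)` of `ℝ^{0|1} × Spec A`, since `ℝ^{0|1} × Spec A` is
represented by `ℝ[θ] ⊗ A`. This is a Yoneda argument, valid for every superalgebra `A`
(`sectionIso`).

A morphism `f₀ + θ f₁ : C^∞(X) ⟶ ℝ[θ] ⊗ A` is an even morphism `f₀ : C^∞(X) → A` with an odd
derivation `f₁` over it. To compare it with a morphism `Ω^*(X) ⟶ A`, finitely many functions `h_j`
and vector fields `Y_j` with `v = ∑ j, dh_j(v) Y_j` for all tangent vectors `v` are used
(`exists_dualFrame`). The `h_j` are the coordinates of an immersion of `X` in a Euclidean space,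
which exists by Baire's theorem and a dimension count (`exists_contMDiff_injective_mfderiv`), and
the `Y_j` come from the pseudo-inverse of its differential. Each form is then a polynomial in the
`dh_j` with the values of the form on the `Y_j` as coefficients. Hence morphisms on `Ω^*(X)` are
determined by functions and their differentials (`DualFrame.hom_ext`), and `f₀` together with
arbitrary odd elements `θ_j` extends to the morphism `ω ↦ ∑ I, f₀(ω_I) θ_I`
(`DualFrame.extendHom`). For `θ_j = f₁(h_j)` it sends `dg` to `∑ j, f₀(Y_j g) f₁(h_j)`.

That this sum is `f₁(g)` is the place where `A` has to be smoothly closed geometric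
(`odd_derivation_eq_sum`). Since `A¹` is a geometric module, the identity may be checked in `A¹ /
ker(x) A¹` for each real point `x` of the heart. The induced real point of `C^∞(X)` is a point `p`
of `X` (`exists_eq_evalPoint`). Functions that vanish at `p` act nilpotently on `A¹ / ker(x) A¹`,
and by Hadamard's lemma the ideal of `p` is finitely generated and `g` is affine in the `h_j`
modulo its square. Under these conditions the identity is a Nakayama type argument
(`derivation_eq_sum`).

Finally `Ω^*(X)` is itself smoothly closed geometric (`isSCG_forms`): its heart is `C^∞(X)`. So
`Hom(ℝ^{0|1}, X)` is represented by an object of the category, and by the Yoneda lemma the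
functions on it are the even elements of `Ω^*(X)` (`functionsEquiv`).
-/

noncomputable section

namespace Super

open SuperAlg

/-! ### Derivations with values in a module on which an ideal acts nilpotently -/

/-- Let `m` be a finitely generated ideal of `R` whose elements act nilpotently on `V`. If modulo
`m ^ 2` every `g` is affine in the `h j`, with the values of `Y j g` modulo `m` as coefficients,
then `D g = ∑ j, Y j g • D (h j)` for every derivation `D : R → V`.

The difference `Δ` of both sides is a derivation with `∑ j, Y j g • Δ (h j) = 0`, so the span `W`
of its values satisfies `W = m W`, and a power of `m` acts by zero. -/
theorem derivation_eq_sum {R V : Type*} [CommRing R] [Algebra ℝ R] [AddCommGroup V] [Module ℝ V]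
    [Module R V] [IsScalarTower ℝ R V] (m : Ideal R) (hfg : m.FG)
    (hnil : ∀ g ∈ m, ∃ k : ℕ, ∀ v : V, g ^ k • v = 0) {ι : Type*} [Fintype ι]
    (D : Derivation ℝ R V) (h : ι → R) (Y : ι → Derivation ℝ R R)
    (hY : ∀ i g, Y i g = ∑ j, Y j g * Y i (h j))
    (hm : ∀ g, ∃ (r : ℝ) (c : ι → ℝ), g - algebraMap ℝ R r - ∑ j, c j • h j ∈ m ^ 2 ∧
      ∀ j, Y j g - algebraMap ℝ R (c j) ∈ m) (g : R) :
    D g = ∑ j, Y j g • D (h j) := by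
  obtain ⟨k, hk⟩ : ∃ k, m ^ k ≤ Module.annihilator R V :=
    Ideal.exists_pow_le_of_le_radical_of_fg (fun g hg => by
      obtain ⟨k, hk⟩ := hnil g hg
      exact ⟨k, Module.mem_annihilator.2 hk⟩) hfg
  let Δ : Derivation ℝ R V :=
    D - ∑ j, (LinearMap.toSpanSingleton R V (D (h j))).compDer (Y j)
  have hΔ (g : R) : Δ g = D g - ∑ j, Y j g • D (h j) := by
    have : ∀ s : Finset ι, (∑ j ∈ s, (LinearMap.toSpanSingleton R V (D (h j))).compDer (Y j)) g =
        ∑ j ∈ s, Y j g • D (h j) := fun s => by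
      classical
      induction s using Finset.induction_on with
      | empty => simp
      | insert a s ha ih =>
        rw [Finset.sum_insert ha, Finset.sum_insert ha, Derivation.add_apply, ih]
        rfl
    rw [Derivation.sub_apply, this]
  let W : Submodule R V := Submodule.span R (Set.range Δ)
  have hmem (g : R) : Δ g ∈ W := Submodule.subset_span ⟨g, rfl⟩
  have hsq (g : R) (hg : g ∈ m ^ 2) : Δ g ∈ m • W := by
    rw [pow_two] at hg
    induction hg using Submodule.mul_induction_on' with
    | mem_mul_mem a ha b hb =>
      rw [Derivation.leibniz]
      exact add_mem (Submodule.smul_mem_smul ha (hmem b)) (Submodule.smul_mem_smul hb (hmem a))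
    | add a _ b _ ha hb => rw [map_add]; exact add_mem ha hb
  have hsum (g : R) : ∑ j, Y j g • Δ (h j) = 0 := by
    simp only [hΔ, smul_sub, Finset.sum_sub_distrib, Finset.smul_sum, smul_smul]
    rw [Finset.sum_comm, sub_eq_zero]
    refine Finset.sum_congr rfl fun i _ => ?_
    rw [← Finset.sum_smul, ← hY]
  have hW : W ≤ m • W := by
    refine Submodule.span_le.2 ?_
    rintro _ ⟨g, rfl⟩
    obtain ⟨r, c, h1, h2⟩ := hm g
    have e : Δ g = Δ (g - algebraMap ℝ R r - ∑ j, c j • h j) -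
        ∑ j, (Y j g - algebraMap ℝ R (c j)) • Δ (h j) := by
      simp only [sub_smul, Finset.sum_sub_distrib, hsum, map_sub, Derivation.map_algebraMap,
        map_sum, Derivation.map_smul, algebraMap_smul]
      abel
    rw [SetLike.mem_coe, e]
    exact sub_mem (hsq _ h1) (sum_mem fun j _ => Submodule.smul_mem_smul (h2 j) (hmem _))
  have hWk : ∀ k : ℕ, W ≤ m ^ k • W := fun k => by
    induction k with
    | zero => simp
    | succ k ih =>
      calc W ≤ m • W := hW
        _ ≤ m • (m ^ k • W) := smul_mono_right m ih
        _ = m ^ (k + 1) • W := by rw [pow_succ', ← smul_eq_mul, Submodule.smul_assoc]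
  have h0 : Δ g ∈ (⊥ : Submodule R V) := by
    have h1 : m ^ k • W ≤ ⊥ := Submodule.smul_le.2 fun a ha v _ =>
      (Submodule.mem_bot R).2 (Module.mem_annihilator.1 (hk ha) v)
    exact h1 (hWk k (hmem g))
  rw [Submodule.mem_bot, hΔ, sub_eq_zero] at h0
  exact h0

/-! ### Hadamard's lemma -/

/-- Smoothness of `u ↦ ∫ w(t) H(t u) dt`. The derivative is an integral of the same form, with `t
w(t)` instead of `w(t)` and `fderiv ℝ H` instead of `H`, hence the induction over all `w` and `H`.
-/
theorem contDiff_integral_smul {E : Type u} [NormedAddCommGroup E] [NormedSpace ℝ E]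
    [FiniteDimensional ℝ E] (k : ℕ) : ∀ {F : Type u} [NormedAddCommGroup F] [NormedSpace ℝ F]
    [CompleteSpace F] {H : E → F} {w : ℝ → ℝ}, ContDiff ℝ ∞ H → Continuous w →
    ContDiff ℝ k (fun u => ∫ t in (0 : ℝ)..1, w t • H (t • u)) := by
  have key {F : Type u} [NormedAddCommGroup F] [NormedSpace ℝ F]
      [CompleteSpace F] {H : E → F} {w : ℝ → ℝ} (hH : ContDiff ℝ ∞ H) (hw : Continuous w) (u₀ : E) :
      HasFDerivAt (fun u => ∫ t in (0 : ℝ)..1, w t • H (t • u))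
        (∫ t in (0 : ℝ)..1, (w t * t) • fderiv ℝ H (t • u₀)) u₀ := by
    have hc : Continuous (fderiv ℝ H) := hH.continuous_fderiv (by simp)
    have hcont : Continuous fun p : ℝ × E => (w p.1 * p.1) • fderiv ℝ H (p.1 • p.2) := by fun_prop
    obtain ⟨C, hC⟩ := (isCompact_Icc (a := (0 : ℝ)) (b := 1)).prod
      (isCompact_closedBall u₀ 1) |>.exists_bound_of_continuousOn hcont.continuousOn
    have hHc := hH.continuous
    have : SecondCountableTopologyEither ℝ (E →L[ℝ] F) := secondCountableTopologyEither_of_left _ _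
    refine intervalIntegral.hasFDerivAt_integral_of_dominated_of_fderiv_le (bound := fun _ => C)
      (F' := fun u t => (w t * t) • fderiv ℝ H (t • u))
      (Metric.ball_mem_nhds u₀ one_pos) ?_ ?_ ?_ ?_ (by simp) ?_
    · exact .of_forall fun u => Continuous.aestronglyMeasurable (by fun_prop)
    · exact Continuous.intervalIntegrable (by fun_prop) _ _
    · exact Continuous.aestronglyMeasurable (by fun_prop)
    · refine .of_forall fun t ht u hu => hC (t, u) ⟨?_, Metric.ball_subset_closedBall hu⟩
      rw [Set.uIoc_of_le zero_le_one] at ht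
      exact ⟨ht.1.le, ht.2⟩
    · refine .of_forall fun t _ u _ => ?_
      have h1 : HasFDerivAt H (fderiv ℝ H (t • u)) (t • u) :=
        (hH.differentiable (by simp) _).hasFDerivAt
      have h2 : HasFDerivAt (fun u : E => t • u) (t • ContinuousLinearMap.id ℝ E) u :=
        (hasFDerivAt_id u).const_smul t
      have h3 := (h1.comp u h2).const_smul (w t)
      refine h3.congr_fderiv ?_
      ext v
      simp [smul_smul]
  induction k with
  | zero =>
    intro F _ _ _ H w hH hw
    exact contDiff_zero.2 (continuous_iff_continuousAt.2 fun u => (key hH hw u).continuousAt)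
  | succ k ih =>
    intro F _ _ _ H w hH hw
    rw [Nat.cast_add, Nat.cast_one, contDiff_succ_iff_hasFDerivAt]
    exact ⟨_, ih (hH.fderiv_right (m := ∞) (by simp)) (hw.mul continuous_id), key hH hw⟩

/-- Hadamard's lemma: `G - G a` is a combination of the coordinates `u i - a i`, with the smooth
coefficients `K i u = ∫ t in 0..1, ∂ᵢ G (a + t (u - a))`. -/
theorem exists_hadamard {n : ℕ} {G : EuclideanSpace ℝ (Fin n) → ℝ} (hG : ContDiff ℝ ∞ G)
    (a : EuclideanSpace ℝ (Fin n)) :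
    ∃ K : Fin n → EuclideanSpace ℝ (Fin n) → ℝ, (∀ i, ContDiff ℝ ∞ (K i)) ∧
      (∀ i, K i a = fderiv ℝ G a (EuclideanSpace.single i 1)) ∧
      ∀ u, G u = G a + ∑ i, (u i - a i) * K i u := by
  let H : EuclideanSpace ℝ (Fin n) → EuclideanSpace ℝ (Fin n) →L[ℝ] ℝ := fun v => fderiv ℝ G (a + v)
  have hH : ContDiff ℝ ∞ H :=
    (hG.fderiv_right (m := ∞) (by simp)).comp (contDiff_const.add contDiff_id)
  let L : EuclideanSpace ℝ (Fin n) → EuclideanSpace ℝ (Fin n) →L[ℝ] ℝ := fun v =>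
    ∫ t in (0 : ℝ)..1, (1 : ℝ) • H (t • v)
  have hL : ContDiff ℝ ∞ L :=
    contDiff_infty.2 fun k => contDiff_integral_smul k (w := fun _ => 1) hH continuous_const
  refine ⟨fun i u => L (u - a) (EuclideanSpace.single i 1), fun i => ?_, fun i => ?_, fun u => ?_⟩
  · exact (hL.comp (contDiff_id.sub contDiff_const)).clm_apply contDiff_const
  · simp [L, H]
  · have h1 : ∑ i, (u i - a i) * L (u - a) (EuclideanSpace.single i 1) = L (u - a) (u - a) := by
      have e := (EuclideanSpace.basisFun (Fin n) ℝ).sum_repr (u - a)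
      calc _ = L (u - a) (∑ i, (EuclideanSpace.basisFun (Fin n) ℝ).repr (u - a) i •
            EuclideanSpace.basisFun (Fin n) ℝ i) := by simp [map_sum]
        _ = _ := by rw [e]
    rw [h1]
    have hc : Continuous H := hH.continuous
    have h2 : L (u - a) (u - a) = ∫ t in (0 : ℝ)..1, H (t • (u - a)) (u - a) := by
      simp only [L, one_smul]
      rw [ContinuousLinearMap.intervalIntegral_apply]
      exact Continuous.intervalIntegrable (by fun_prop) _ _
    have h3 : ∫ t in (0 : ℝ)..1, H (t • (u - a)) (u - a) = G (a + (1 : ℝ) • (u - a)) -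
        G (a + (0 : ℝ) • (u - a)) := by
      refine intervalIntegral.integral_eq_sub_of_hasDerivAt
        (f := fun t : ℝ => G (a + t • (u - a))) (fun t _ => ?_)
        (Continuous.intervalIntegrable (by fun_prop) _ _)
      have h4 : HasDerivAt (fun t : ℝ => a + t • (u - a)) ((1 : ℝ) • (u - a)) t :=
        ((hasDerivAt_id t).smul_const (u - a)).const_add a
      rw [one_smul] at h4
      exact (hG.differentiable (by simp) _).hasFDerivAt.comp_hasDerivAt t h4
    rw [h2, h3]
    simp

/-! ### Generic injectivity of differentials -/

open Module in
/-- A linear map that is not injective factors through a space of dimension one less than its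
source. This parametrizes such maps smoothly. -/
theorem exists_factorization_of_not_injective {E F : Type} [NormedAddCommGroup E] [NormedSpace ℝ E]
    [FiniteDimensional ℝ E] [NormedAddCommGroup F] [NormedSpace ℝ F] [FiniteDimensional ℝ F]
    (L : E →L[ℝ] F) (hL : ¬ Function.Injective L) :
    ∃ (A : EuclideanSpace ℝ (Fin (finrank ℝ E - 1)) →L[ℝ] F)
      (B : E →L[ℝ] EuclideanSpace ℝ (Fin (finrank ℝ E - 1))), L = A ∘L B := by
  have hker : 1 ≤ finrank ℝ (LinearMap.ker (L : E →ₗ[ℝ] F)) := by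
    rw [Nat.one_le_iff_ne_zero]
    intro h
    exact hL (LinearMap.ker_eq_bot.1 (Submodule.finrank_eq_zero.1 h))
  have hsum := LinearMap.finrank_range_add_finrank_ker (L : E →ₗ[ℝ] F)
  have hle : finrank ℝ (LinearMap.range (L : E →ₗ[ℝ] F)) ≤
      finrank ℝ (EuclideanSpace ℝ (Fin (finrank ℝ E - 1))) := by
    rw [finrank_euclideanSpace_fin]; omega
  obtain ⟨e, he⟩ := finrank_le_iff_exists_linearMap.1 hle
  obtain ⟨r, hr⟩ := LinearMap.exists_leftInverse_of_injective e (LinearMap.ker_eq_bot.2 he)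
  refine ⟨LinearMap.toContinuousLinearMap ((LinearMap.range (L : E →ₗ[ℝ] F)).subtype ∘ₗ r),
    LinearMap.toContinuousLinearMap (e ∘ₗ (L : E →ₗ[ℝ] F).rangeRestrict), ?_⟩
  ext v
  have := LinearMap.congr_fun hr ((L : E →ₗ[ℝ] F).rangeRestrict v)
  simp only [LinearMap.comp_apply, LinearMap.id_apply] at this
  simp [this]

open Module in
/-- For generic `c : ι → (E →L[ℝ] F)`, all the maps `∑ j, c j ∘ D(ψ k j)(u)`, for `u` in the
compact set `C k`, are injective, provided that one of the functions `ψ k j` is the identity on the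
neighbourhood `s k` of `C k`.

By compactness, for each `k` the condition on `c` is open in the product topology. It is dense
since the coefficients of the identity that violate it are the values of a smooth function `Ψ` on a
space of dimension less than `dim E * dim F`. Baire's theorem treats all `k` at once. -/
theorem exists_forall_injective_sum_comp_fderiv {E F : Type} [NormedAddCommGroup E]
    [NormedSpace ℝ E] [FiniteDimensional ℝ E] [NormedAddCommGroup F] [NormedSpace ℝ F]
    [FiniteDimensional ℝ F] {ι κ : Type*} [Countable ι] [Countable κ] (i : κ → ι)
    (S : κ → Finset ι) (hi : ∀ k, i k ∈ S k) (C s : κ → Set E) (hC : ∀ k, IsCompact (C k))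
    (hCs : ∀ k, C k ⊆ s k) (hs : ∀ k, IsOpen (s k)) (hconv : ∀ k, Convex ℝ (s k))
    (ψ : κ → ι → E → E) (hψ : ∀ k, ∀ j ∈ S k, ContDiffOn ℝ ∞ (ψ k j) (s k))
    (hid : ∀ k, Set.EqOn (ψ k (i k)) id (s k)) (hdim : finrank ℝ E ^ 2 < finrank ℝ F) :
    ∃ c : ι → E →L[ℝ] F, ∀ k, ∀ u ∈ C k,
      Function.Injective (∑ j ∈ S k, c j ∘L fderiv ℝ (ψ k j) u : E →L[ℝ] F) := by
  classical
  rcases subsingleton_or_nontrivial E with hE | hE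
  · exact ⟨0, fun k u _ => Function.injective_of_subsingleton _⟩
  have hpos : 0 < finrank ℝ E := finrank_pos
  let G (k : κ) : Set (ι → E →L[ℝ] F) :=
    {c | ∀ u ∈ C k, Function.Injective (∑ j ∈ S k, c j ∘L fderiv ℝ (ψ k j) u : E →L[ℝ] F)}
  have hfd (k : κ) (j) (hj : j ∈ S k) : ContDiffOn ℝ ∞ (fderiv ℝ (ψ k j)) (s k) :=
    (hψ k j hj).fderiv_of_isOpen (hs k) (by simp)
  have hGo (k : κ) : IsOpen (G k) := by
    refine isOpen_iff_mem_nhds.2 fun c hc => ?_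
    refine (hC k).eventually_forall_of_forall_eventually
      (P := fun (c : ι → E →L[ℝ] F) u =>
        Function.Injective (∑ j ∈ S k, c j ∘L fderiv ℝ (ψ k j) u : E →L[ℝ] F)) fun u hu => ?_
    have hcont : ContinuousAt (fun z : (ι → E →L[ℝ] F) × E =>
        ∑ j ∈ S k, z.1 j ∘L fderiv ℝ (ψ k j) z.2) (c, u) := by
      refine tendsto_finsetSum _ fun j hj => ?_
      have h1 : ContinuousAt (fderiv ℝ (ψ k j)) u :=
        ((hfd k j hj).continuousOn).continuousAt ((hs k).mem_nhds (hCs k hu))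
      have h2 : ContinuousAt (fun z : (ι → E →L[ℝ] F) × E => z.1 j) (c, u) := by fun_prop
      exact h2.clm_comp (h1.comp (x := (c, u)) continuousAt_snd)
    exact hcont (ContinuousLinearMap.isOpen_injective.mem_nhds (hc u hu))
  have hGd (k : κ) : Dense (G k) := by
    refine dense_iff_inter_open.2 fun O hO ⟨c, hc⟩ => ?_
    -- only the coefficient of the function equal to the coordinate on `s k` is changed
    let H := EuclideanSpace ℝ (Fin (finrank ℝ E - 1))
    let Ψ : E × (H →L[ℝ] F) × (E →L[ℝ] H) → (E →L[ℝ] F) := fun p =>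
      p.2.1 ∘L p.2.2 - ∑ j ∈ (S k).erase (i k), c j ∘L fderiv ℝ (ψ k j) p.1
    have hΨ : ContDiffOn ℝ 1 Ψ (s k ×ˢ Set.univ) := by
      refine ContDiffOn.sub ?_ (ContDiffOn.sum fun j hj => ?_)
      · exact ContDiffOn.clm_comp (contDiff_fst.comp contDiff_snd).contDiffOn
          (contDiff_snd.comp contDiff_snd).contDiffOn
      · have h1 := ((hfd k j (Finset.mem_of_mem_erase hj)).of_le (m := 1) (by simp)).comp
          (t := s k) (s := s k ×ˢ (Set.univ : Set ((H →L[ℝ] F) × (E →L[ℝ] H))))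
          contDiff_fst.contDiffOn (fun p hp => hp.1)
        exact contDiffOn_const.clm_comp h1
    have hlt : dimH (s k ×ˢ (Set.univ : Set ((H →L[ℝ] F) × (E →L[ℝ] H)))) <
        finrank ℝ (E →L[ℝ] F) := by
      refine (dimH_mono (Set.subset_univ _)).trans_lt ?_
      rw [Real.dimH_univ_eq_finrank]
      have e1 : finrank ℝ (H →L[ℝ] F) = (finrank ℝ E - 1) * finrank ℝ F := by
        rw [← (LinearMap.toContinuousLinearMap (𝕜 := ℝ) (E := H) (F' := F)).finrank_eq,
          finrank_linearMap, finrank_euclideanSpace_fin]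
      have e2 : finrank ℝ (E →L[ℝ] H) = finrank ℝ E * (finrank ℝ E - 1) := by
        rw [← (LinearMap.toContinuousLinearMap (𝕜 := ℝ) (E := E) (F' := H)).finrank_eq,
          finrank_linearMap, finrank_euclideanSpace_fin]
      have e3 : finrank ℝ (E →L[ℝ] F) = finrank ℝ E * finrank ℝ F := by
        rw [← (LinearMap.toContinuousLinearMap (𝕜 := ℝ) (E := E) (F' := F)).finrank_eq,
          finrank_linearMap]
      rw [finrank_prod, finrank_prod, e1, e2, e3]
      refine Nat.cast_lt.2 ?_
      obtain ⟨d, hd⟩ : ∃ d, finrank ℝ E = d + 1 := ⟨_, (Nat.succ_pred_eq_of_pos hpos).symm⟩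
      -- with `dim E = d + 1`: `(d + 1) + (d * dim F + (d + 1) * d) < (d + 1) * dim F`
      rw [hd] at hdim ⊢
      rw [Nat.add_sub_cancel]
      nlinarith
    have hdense := hΨ.dense_compl_image_of_dimH_lt_finrank
      ((hconv k).prod convex_univ) subset_rfl hlt
    have hup : Continuous fun c' : E →L[ℝ] F => Function.update c (i k) c' :=
      continuous_const.update (i k) continuous_id
    obtain ⟨c', hc'O, hc'⟩ := hdense.inter_open_nonempty _ (hO.preimage hup) ⟨c (i k), by simpa⟩
    refine ⟨Function.update c (i k) c', hc'O, fun u hu => ?_⟩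
    by_contra hinj
    obtain ⟨A, B, hAB⟩ := exists_factorization_of_not_injective _ hinj
    refine hc' ⟨(u, A, B), ⟨hCs k hu, trivial⟩, ?_⟩
    have hfid : fderiv ℝ (ψ k (i k)) u = ContinuousLinearMap.id ℝ E := by
      have : ψ k (i k) =ᶠ[nhds u] id :=
        Filter.eventuallyEq_of_mem ((hs k).mem_nhds (hCs k hu)) (hid k)
      rw [this.fderiv_eq, fderiv_id]
    have hrest : ∑ j ∈ (S k).erase (i k), Function.update c (i k) c' j ∘L fderiv ℝ (ψ k j) u =
        ∑ j ∈ (S k).erase (i k), c j ∘L fderiv ℝ (ψ k j) u :=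
      Finset.sum_congr rfl fun j hj => by rw [Function.update_of_ne (Finset.ne_of_mem_erase hj)]
    rw [← Finset.add_sum_erase _ _ (hi k), hrest, hfid, Function.update_self,
      ContinuousLinearMap.comp_id] at hAB
    simp only [Ψ, ← hAB, add_sub_cancel_right]
  obtain ⟨c, hc⟩ := (dense_iInter_of_isOpen hGo hGd).nonempty
  exact ⟨c, fun k => Set.mem_iInter.1 hc k⟩

/-! ### Immersions in Euclidean space -/

section Manifold

variable {n : ℕ} {X : Type u} [TopologicalSpace X] [ChartedSpace (EuclideanSpace ℝ (Fin n)) X]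
  [IsManifold (𝓡 n) ∞ X]

/-- Every manifold of dimension `n` has an immersion in `ℝ^(n ^ 2 + 1)`, of the form `∑ j, c j (f j
• φ j)` with the bump functions `f j` and the charts `φ j` of a locally finite covering and generic
linear maps `c j`. -/
theorem exists_contMDiff_injective_mfderiv [T2Space X] [SecondCountableTopology X] :
    ∃ H : X → EuclideanSpace ℝ (Fin (n ^ 2 + 1)),
      ContMDiff (𝓡 n) 𝓘(ℝ, EuclideanSpace ℝ (Fin (n ^ 2 + 1))) ∞ H ∧
      ∀ x, Function.Injective (mfderiv (𝓡 n) 𝓘(ℝ, EuclideanSpace ℝ (Fin (n ^ 2 + 1))) H x) := by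
  classical
  have : LocallyCompactSpace X := ChartedSpace.locallyCompactSpace (EuclideanSpace ℝ (Fin n)) X
  obtain ⟨ι, f, -⟩ := SmoothBumpCovering.exists_isSubordinate (𝓡 n) (M := X)
    (U := fun _ => Set.univ)
    isClosed_univ (fun x _ => Filter.univ_mem)
  have hcount : Countable ι := Set.countable_univ_iff.1
    (f.locallyFinite.countable_univ fun i => (f i).nonempty_support)
  let φ (i : ι) := extChartAt (𝓡 n) (f.c i)
  let Ψ (i : ι) (x : X) : EuclideanSpace ℝ (Fin n) := f i x • φ i x
  have hΨ (i : ι) : ContMDiff (𝓡 n) 𝓘(ℝ, EuclideanSpace ℝ (Fin n)) ∞ (Ψ i) :=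
    (f i).contMDiff_smul contMDiffOn_extChartAt
  have hφs (i : ι) : ContMDiffOn 𝓘(ℝ, EuclideanSpace ℝ (Fin n)) (𝓡 n) ∞ (φ i).symm (φ i).target :=
    contMDiffOn_extChartAt_symm _
  -- every point has a ball in a chart of the covering on which the corresponding bump function is
  -- one and which meets the supports of finitely many bump functions only
  have hloc (x : X) : ∃ (i : ι) (S : Finset ι) (r : ℝ), i ∈ S ∧ 0 < r ∧ x ∈ (φ i).source ∧
      Metric.ball (φ i x) r ⊆ (φ i).target ∧
      ∀ u ∈ Metric.ball (φ i x) r, f i ((φ i).symm u) = 1 ∧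
        ∀ j, f j ((φ i).symm u) ≠ 0 → j ∈ S := by
    let i := f.ind x trivial
    have hx : x ∈ (φ i).source := f.mem_extChartAt_ind_source x trivial
    obtain ⟨U, hU, hfin⟩ := f.locallyFinite x
    have h1 : ∀ᶠ y in nhds x, f i y = 1 ∧ y ∈ U := (f.eventuallyEq_one x trivial).and hU
    have h2 : ∀ᶠ u in nhds (φ i x), (f i ((φ i).symm u) = 1 ∧ (φ i).symm u ∈ U) ∧
        u ∈ (φ i).target := by
      refine Filter.Eventually.and ?_ (extChartAt_target_mem_nhds' ((φ i).map_source hx))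
      have h3 := (continuousAt_extChartAt_symm' hx).tendsto
      rw [(extChartAt (𝓡 n) (f.c i)).left_inv hx] at h3
      exact h3.eventually h1
    obtain ⟨r, hr, hball⟩ := Metric.eventually_nhds_iff_ball.1 h2
    refine ⟨i, insert i hfin.toFinset, r, Finset.mem_insert_self _ _, hr, hx,
      fun u hu => (hball u hu).2, fun u hu => ⟨(hball u hu).1.1, fun j hj =>
        Finset.mem_insert_of_mem ((Set.Finite.mem_toFinset _).2 ⟨_, hj, (hball u hu).1.2⟩)⟩⟩
  choose i S r hiS hr hsrc htgt hone using hloc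
  obtain ⟨T, hT, hcov⟩ := TopologicalSpace.countable_cover_nhds
    (f := fun x => (φ (i x)).source ∩ φ (i x) ⁻¹' Metric.closedBall (φ (i x) x) (r x / 2))
    (fun x => Filter.inter_mem (extChartAt_source_mem_nhds' (hsrc x))
      ((continuousAt_extChartAt' (hsrc x)).preimage_mem_nhds
        (Metric.closedBall_mem_nhds _ (half_pos (hr x)))))
  have : Countable T := hT
  have hsub (x : X) : Metric.closedBall (φ (i x) x) (r x / 2) ⊆ Metric.ball (φ (i x) x) (r x) :=
    Metric.closedBall_subset_ball (half_lt_self (hr x))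
  obtain ⟨c, hc⟩ := exists_forall_injective_sum_comp_fderiv
    (F := EuclideanSpace ℝ (Fin (n ^ 2 + 1))) (κ := T)
    (fun k => i k) (fun k => S k) (fun k => hiS k)
    (fun k => Metric.closedBall (φ (i k) k) (r k / 2)) (fun k => Metric.ball (φ (i k) k) (r k))
    (fun k => isCompact_closedBall _ _) (fun k => hsub k) (fun k => Metric.isOpen_ball)
    (fun k => convex_ball _ _) (fun k j u => Ψ j ((φ (i k)).symm u))
    (fun k j _ => ((hΨ j).comp_contMDiffOn ((hφs (i k)).mono (htgt k))).contDiffOn)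
    (fun k u hu => by
      simp only [Ψ, (hone k u hu).1, one_smul, id]
      exact (φ (i k)).right_inv (htgt k hu))
    (by simp)
  let H (x : X) := ∑ᶠ j, c j (Ψ j x)
  have hH : ContMDiff (𝓡 n) 𝓘(ℝ, EuclideanSpace ℝ (Fin (n ^ 2 + 1))) ∞ H := by
    refine contMDiff_finsum (fun j => (c j).contMDiff.comp (hΨ j)) (f.locallyFinite.subset ?_)
    intro j x hx h0
    refine hx ?_
    simp [Ψ, h0]
  refine ⟨H, hH, fun y => ?_⟩
  obtain ⟨x, hxT, hysrc, hy⟩ : ∃ x ∈ T, y ∈ (φ (i x)).source ∧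
      φ (i x) y ∈ Metric.closedBall (φ (i x) x) (r x / 2) := by
    have : y ∈ ⋃ x ∈ T, (φ (i x)).source ∩ φ (i x) ⁻¹' Metric.closedBall (φ (i x) x) (r x / 2) :=
      hcov ▸ Set.mem_univ y
    obtain ⟨x, hx, h⟩ := Set.mem_iUnion₂.1 this
    exact ⟨x, hx, h⟩
  have hinj := hc ⟨x, hxT⟩ _ hy
  have hnhds := Metric.isOpen_ball.mem_nhds (hsub x hy)
  have heq : (fun u => H ((φ (i x)).symm u)) =ᶠ[nhds (φ (i x) y)]
      fun u => ∑ j ∈ S x, c j (Ψ j ((φ (i x)).symm u)) := by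
    refine Filter.eventuallyEq_of_mem hnhds fun u hu => ?_
    refine finsum_eq_sum_of_support_subset _ fun j hj => (hone x u hu).2 j fun h0 => hj ?_
    simp [Ψ, h0]
  have hfd : fderiv ℝ (fun u => H ((φ (i x)).symm u)) (φ (i x) y) =
      ∑ j ∈ S x, c j ∘L fderiv ℝ (fun u => Ψ j ((φ (i x)).symm u)) (φ (i x) y) := by
    have hd (j : ι) : DifferentiableAt ℝ (fun u => Ψ j ((φ (i x)).symm u)) (φ (i x) y) :=
      (((hΨ j).comp_contMDiffOn ((hφs (i x)).mono (htgt x))).contDiffOn.contDiffAt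
        hnhds).differentiableAt (by simp)
    rw [heq.fderiv_eq]
    exact (HasFDerivAt.fun_sum fun j _ => (c j).hasFDerivAt.comp _ (hd j).hasFDerivAt).fderiv
  have hdiff : DifferentiableAt ℝ (fun u => H ((φ (i x)).symm u)) (φ (i x) y) :=
    ((hH.comp_contMDiffOn ((hφs (i x)).mono (htgt x))).contDiffOn.contDiffAt
        hnhds).differentiableAt (by simp)
  have hcomp : H =ᶠ[nhds y] (fun u => H ((φ (i x)).symm u)) ∘ φ (i x) :=
    Filter.eventuallyEq_of_mem (extChartAt_source_mem_nhds' hysrc) fun z hz => by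
      simp only [Function.comp_apply]
      rw [(φ (i x)).left_inv hz]
  have hφd : MDifferentiableAt (𝓡 n) 𝓘(ℝ, EuclideanSpace ℝ (Fin n)) (φ (i x)) y :=
    mdifferentiableAt_extChartAt (by simpa [φ] using hysrc)
  rw [hcomp.mfderiv_eq, mfderiv_comp _ hdiff.mdifferentiableAt hφd, mfderiv_eq_fderiv, hfd]
  have h1 : Function.Injective (mfderiv (𝓡 n) 𝓘(ℝ, EuclideanSpace ℝ (Fin n)) (φ (i x)) y) :=
    (isInvertible_mfderiv_extChartAt hysrc).injective
  exact hinj.comp h1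

end Manifold

/-! ### Real points of the algebra of smooth functions -/

section Evaluation

variable {n : ℕ} {X : Type u} [TopologicalSpace X] [ChartedSpace (EuclideanSpace ℝ (Fin n)) X]

/-- Evaluation at a point of `X`, as a real point of the algebra `C^∞(X)`. -/
def evalPoint (p : X) : C^∞⟮𝓡 n, X; 𝓘(ℝ, ℝ), ℝ⟯ →ₐ[ℝ] ℝ :=
  (Pi.evalAlgHom ℝ (fun _ : X => ℝ) p).comp ContMDiffMap.coeFnAlgHom

@[simp] theorem evalPoint_apply (p : X) (g : C^∞⟮𝓡 n, X; 𝓘(ℝ, ℝ), ℝ⟯) : evalPoint p g = g p := rfl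

end Evaluation

section Manifold

variable {n : ℕ} {X : Type u} [TopologicalSpace X] [ChartedSpace (EuclideanSpace ℝ (Fin n)) X]
  [IsManifold (𝓡 n) ∞ X]

theorem exists_smooth_exhaustion [T2Space X] [SecondCountableTopology X] :
    ∃ f : C^∞⟮𝓡 n, X; 𝓘(ℝ, ℝ), ℝ⟯, ∀ c : ℝ, IsCompact {x | f x = c} := by
  have : LocallyCompactSpace X := ChartedSpace.locallyCompactSpace (EuclideanSpace ℝ (Fin n)) X
  let K := CompactExhaustion.choice X
  obtain ⟨f, hf⟩ := exists_contMDiffMap_forall_mem_convex_of_local_const (I := 𝓡 n) (n := ⊤)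
    (t := fun x : X => Set.Ici (K.find x : ℝ)) (fun x => convex_Ici _) (fun x => by
      refine ⟨(K.find x + 1 : ℕ), ?_⟩
      filter_upwards [mem_interior_iff_mem_nhds.1
        (K.subset_interior_succ _ (K.mem_find x))] with y hy
      exact Set.mem_Ici.2 (Nat.cast_le.2 (K.mem_iff_find_le.1 hy)))
  refine ⟨f, fun c => (K.isCompact ⌈c⌉₊).of_isClosed_subset
    (isClosed_eq f.contMDiff.continuous continuous_const) fun x hx => K.mem_iff_find_le.2 ?_⟩
  have h1 : (K.find x : ℝ) ≤ c := (hf x).trans_eq hx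
  exact_mod_cast h1.trans (Nat.le_ceil c)

/-- Milnor's exercise: every real point of `C^∞(X)` is the evaluation at a point of `X`. -/
theorem exists_eq_evalPoint [T2Space X] [SecondCountableTopology X]
    (χ : C^∞⟮𝓡 n, X; 𝓘(ℝ, ℝ), ℝ⟯ →ₐ[ℝ] ℝ) : ∃ p, χ = evalPoint p := by
  by_contra! hne
  have hg (p : X) : ∃ g, χ g ≠ g p := by
    by_contra! h
    exact hne p (AlgHom.ext h)
  choose g hg using hg
  obtain ⟨f, hf⟩ := exists_smooth_exhaustion (n := n) (X := X)
  -- a sum of squares of functions killed by `χ`, without zeros by compactness of a level set of `f`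
  let sq (h : C^∞⟮𝓡 n, X; 𝓘(ℝ, ℝ), ℝ⟯) : C^∞⟮𝓡 n, X; 𝓘(ℝ, ℝ), ℝ⟯ := (h - algebraMap ℝ _ (χ h)) ^ 2
  have hsq (h) (x : X) : sq h x = (h x - χ h) ^ 2 := rfl
  have hχ (h) : χ (sq h) = 0 := by simp [sq]
  obtain ⟨t, -, ht⟩ := (hf (χ f)).elim_nhds_subcover (fun p => {x | sq (g p) x ≠ 0}) fun p _ =>
    (sq (g p)).contMDiff.continuous.continuousAt.eventually_ne (by
      rw [hsq]; exact pow_ne_zero _ (sub_ne_zero.2 (hg p).symm))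
  let u := sq f + ∑ p ∈ t, sq (g p)
  have hu (x : X) : u x ≠ 0 := by
    have e : u x = (f x - χ f) ^ 2 + ∑ p ∈ t, (g p x - χ (g p)) ^ 2 := by
      rw [← evalPoint_apply, map_add, map_sum]
      rfl
    rw [e]
    by_cases hx : f x = χ f
    · obtain ⟨p, hp, hpx⟩ := Set.mem_iUnion₂.1 (ht hx)
      have h1 : 0 < (g p x - χ (g p)) ^ 2 := (sq_nonneg _).lt_of_ne' hpx
      have h2 := Finset.single_le_sum (f := fun p => (g p x - χ (g p)) ^ 2)
        (fun q _ => sq_nonneg _) hp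
      have h3 := sq_nonneg (f x - χ f)
      linarith
    · have h1 : 0 < (f x - χ f) ^ 2 := by
        have := sub_ne_zero.2 hx
        positivity
      have h2 : 0 ≤ ∑ p ∈ t, (g p x - χ (g p)) ^ 2 := Finset.sum_nonneg fun q _ => sq_nonneg _
      linarith
  let v : C^∞⟮𝓡 n, X; 𝓘(ℝ, ℝ), ℝ⟯ := ⟨fun x => (u x)⁻¹, u.contMDiff.inv₀ hu⟩
  have huv : u * v = 1 := ContMDiffMap.ext fun x => mul_inv_cancel₀ (hu x)
  have h0 : χ u = 0 := by simp only [u, map_add, map_sum, hχ, Finset.sum_const_zero, add_zero]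
  have := congrArg χ huv
  rw [map_mul, h0, zero_mul, map_one] at this
  exact zero_ne_one this

/-- Hadamard's lemma on a manifold: with the functions `x i = ρ (φ i - φ i p)` and `χ = 1 - ρ ^ 3`,
for a chart `φ` and a bump function `ρ` at `p`, every `g` that vanishes at `p` is a combination `∑
i, x i * k i + χ * g`, and the `k i` vanish at `p` if the differential of `g` does. -/
theorem exists_local_hadamard [T2Space X] (p : X) :
    ∃ (x : Fin n → C^∞⟮𝓡 n, X; 𝓘(ℝ, ℝ), ℝ⟯) (χ : C^∞⟮𝓡 n, X; 𝓘(ℝ, ℝ), ℝ⟯),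
      (∀ i, x i p = 0) ∧ χ p = 0 ∧ ∀ g : C^∞⟮𝓡 n, X; 𝓘(ℝ, ℝ), ℝ⟯, g p = 0 →
        ∃ k : Fin n → C^∞⟮𝓡 n, X; 𝓘(ℝ, ℝ), ℝ⟯, g = ∑ i, x i * k i + χ * g ∧
          (mvfderiv (𝓡 n) g p = 0 → ∀ i, k i p = 0) := by
  let φ := extChartAt (𝓡 n) p
  let ρ : SmoothBumpFunction (𝓡 n) p := Classical.arbitrary _
  have hρ0 {y : X} (hy : y ∉ φ.source) : ρ y = 0 := by
    by_contra h
    exact hy (by simpa [φ] using ρ.support_subset_source h)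
  have hφ : ContMDiffOn (𝓡 n) 𝓘(ℝ, EuclideanSpace ℝ (Fin n)) ∞ φ (chartAt _ p).source :=
    contMDiffOn_extChartAt
  have hρs : ContMDiff (𝓡 n) 𝓘(ℝ, ℝ) ∞ ρ := ρ.contMDiff
  have hρp : ρ p = 1 := ρ.eq_one
  let x (i : Fin n) : C^∞⟮𝓡 n, X; 𝓘(ℝ, ℝ), ℝ⟯ := ⟨fun y => ρ y • (φ y i - φ p i),
    ρ.contMDiff_smul (by
      have h : ContMDiffOn (𝓡 n) 𝓘(ℝ, ℝ) ∞ (fun y => φ y i) (chartAt _ p).source :=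
        (EuclideanSpace.proj (𝕜 := ℝ) i).contMDiff.comp_contMDiffOn hφ
      exact h.sub contMDiffOn_const)⟩
  refine ⟨x, ⟨fun y => 1 - ρ y ^ 3, contMDiff_const.sub (hρs.pow 3)⟩, fun i => ?_, ?_,
    fun g hg => ?_⟩
  · change ρ p • (φ p i - φ p i) = 0
    simp
  · change 1 - ρ p ^ 3 = 0
    simp
  · -- `ρ g`, seen in the chart `φ` and extended by zero
    let G : EuclideanSpace ℝ (Fin n) → ℝ := φ.target.indicator fun u => ρ (φ.symm u) * g (φ.symm u)
    have hcl : IsClosed (φ '' tsupport ρ) := by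
      refine (ρ.hasCompactSupport.isCompact.image_of_continuousOn ?_).isClosed
      exact (continuousOn_extChartAt p).mono ρ.tsupport_subset_extChartAt_source
    have hGin {u} (hu : u ∈ φ.target) :
        G =ᶠ[nhds u] fun u => ρ (φ.symm u) * g (φ.symm u) :=
      Filter.eventuallyEq_of_mem ((isOpen_extChartAt_target p).mem_nhds hu) fun v hv =>
        Set.indicator_of_mem hv _
    have hG : ContDiff ℝ ∞ G := contDiff_iff_contDiffAt.2 fun u => by
      by_cases hu : u ∈ φ '' tsupport ρ
      · have hu' : u ∈ φ.target := by
          obtain ⟨y, hy, rfl⟩ := hu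
          exact φ.map_source (ρ.tsupport_subset_extChartAt_source hy)
        have h1 : ContDiffOn ℝ ∞ (fun u => ρ (φ.symm u) * g (φ.symm u)) φ.target :=
          ((hρs.mul g.contMDiff).comp_contMDiffOn (contMDiffOn_extChartAt_symm p)).contDiffOn
        exact (h1.contDiffAt ((isOpen_extChartAt_target p).mem_nhds hu')).congr_of_eventuallyEq
          (hGin hu')
      · have h1 : G =ᶠ[nhds u] fun _ => 0 := by
          refine Filter.eventuallyEq_of_mem (hcl.isOpen_compl.mem_nhds hu) fun v hv => ?_
          by_cases hvt : v ∈ φ.target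
          · have h2 : ρ (φ.symm v) = 0 := by
              by_contra h
              exact hv ⟨_, subset_tsupport _ h, φ.right_inv hvt⟩
            simp [G, hvt, h2]
          · simp [G, hvt]
        exact contDiffAt_const.congr_of_eventuallyEq h1
    obtain ⟨K, hK, hKd, hGK⟩ := exists_hadamard hG (φ p)
    have hpt : φ p ∈ φ.target := mem_extChartAt_target p
    have hGp : G (φ p) = 0 := by
      simp [G, φ, hg]
    refine ⟨fun i => ⟨fun y => ρ y • K i (φ y), ρ.contMDiff_smul
      ((hK i).contMDiff.comp_contMDiffOn hφ)⟩, ContMDiffMap.ext fun y => ?_, fun hd i => ?_⟩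
    · change g y = evalPoint y (∑ i, x i * _ + _ * g)
      simp only [map_add, map_sum, evalPoint_apply]
      change g y = ∑ i, (ρ y • (φ y i - φ p i)) * (ρ y • K i (φ y)) + (1 - ρ y ^ 3) * g y
      by_cases hy : y ∈ φ.source
      · have h1 : G (φ y) = ρ y * g y := by
          simp only [G, Set.indicator_of_mem (φ.map_source hy), φ.left_inv hy]
        have h2 := hGK (φ y)
        rw [h1, hGp, zero_add] at h2
        have h3 : ∑ i, (ρ y • (φ y i - φ p i)) * (ρ y • K i (φ y)) =
            ρ y ^ 2 * ∑ i, (φ y i - φ p i) * K i (φ y) := by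
          rw [Finset.mul_sum]
          exact Finset.sum_congr rfl fun i _ => by simp only [smul_eq_mul]; ring
        rw [h3, ← h2]
        ring
      · simp [hρ0 hy]
    · change ρ p • K i (φ p) = 0
      have hgd : MDifferentiableAt (𝓡 n) 𝓘(ℝ, ℝ) g p :=
        g.contMDiff.mdifferentiableAt (by simp)
      have h1 : G =ᶠ[nhds (φ p)] fun u => g (φ.symm u) := by
        have h2 : ∀ᶠ u in nhds (φ p), ρ (φ.symm u) = 1 := by
          have h3 := (continuousAt_extChartAt_symm (I := 𝓡 n) p).tendsto
          rw [extChartAt_to_inv] at h3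
          exact h3.eventually ρ.eventuallyEq_one
        filter_upwards [hGin hpt, h2] with u hu hu'
        rw [hu, hu', one_mul]
      rw [hgd.mvfderiv] at hd
      have h2 : fderiv ℝ (fun u => g (φ.symm u)) (φ p) = 0 := by
        simpa [writtenInExtChartAt, Function.comp_def, fderivWithin_univ, φ, chartAt_self_eq]
          using! hd
      rw [hKd, h1.fderiv_eq, h2]
      simp

/-- The ideal of the smooth functions that vanish at `p`. -/
abbrev pointIdeal (p : X) : Ideal C^∞⟮𝓡 n, X; 𝓘(ℝ, ℝ), ℝ⟯ := RingHom.ker (evalPoint (n := n) p)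

theorem pointIdeal_fg [T2Space X] (p : X) : (pointIdeal (n := n) p).FG := by
  obtain ⟨x, χ, hx, hχ, h⟩ := exists_local_hadamard (n := n) p
  refine Submodule.fg_def.2 ⟨Set.range x ∪ {χ}, (Set.finite_range x).union (Set.finite_singleton χ),
    le_antisymm ?_ fun g hg => ?_⟩
  · refine Submodule.span_le.2 ?_
    rintro _ (⟨i, rfl⟩ | rfl)
    exacts [hx i, hχ]
  · obtain ⟨k, hk, -⟩ := h g hg
    rw [hk]
    refine add_mem (sum_mem fun i _ => ?_) ?_
    · exact Ideal.mul_mem_right _ _ (Ideal.subset_span (Or.inl ⟨i, rfl⟩))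
    · exact Ideal.mul_mem_right _ _ (Ideal.subset_span (Or.inr rfl))

/-- Functions that vanish to second order at `p` are in the square of the ideal of `p`. -/
theorem mem_pointIdeal_sq [T2Space X] {p : X} {g : C^∞⟮𝓡 n, X; 𝓘(ℝ, ℝ), ℝ⟯} (hg : g p = 0)
    (hd : mvfderiv (𝓡 n) g p = 0) : g ∈ pointIdeal (n := n) p ^ 2 := by
  obtain ⟨x, χ, hx, hχ, h⟩ := exists_local_hadamard (n := n) p
  obtain ⟨k, hk, hk0⟩ := h g hg
  rw [hk, pow_two]
  exact add_mem (sum_mem fun i _ => Ideal.mul_mem_mul (hx i) (hk0 hd i)) (Ideal.mul_mem_mul hχ hg)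

end Manifold

/-! ### Dual frames -/

section Pseudoinverse

variable {E F : Type*} [NormedAddCommGroup E] [InnerProductSpace ℝ E] [FiniteDimensional ℝ E]
  [NormedAddCommGroup F] [InnerProductSpace ℝ F] [FiniteDimensional ℝ F]

open ContinuousLinearMap

/-- The pseudo-inverse `(A†A)⁻¹A†` of a continuous linear map `A`; it is a left inverse of `A` when
`A` is injective. -/
def pseudoinverse (A : E →L[ℝ] F) : F →L[ℝ] E := (adjoint A ∘L A).inverse ∘L adjoint A

theorem exists_equiv_adjoint_comp_self {A : E →L[ℝ] F} (hA : Function.Injective A) :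
    ∃ e : E ≃L[ℝ] E, (e : E →L[ℝ] E) = adjoint A ∘L A := by
  have hinj : Function.Injective (adjoint A ∘L A : E →L[ℝ] E).toLinearMap := by
    refine (injective_iff_map_eq_zero _).2 fun v hv => hA ?_
    have h1 : (adjoint A ∘L A) v = 0 := hv
    have h2 : inner ℝ ((adjoint A ∘L A) v) v = inner ℝ (A v) (A v) := adjoint_inner_left A v (A v)
    rw [h1, inner_zero_left, eq_comm, inner_self_eq_zero] at h2
    rw [h2, map_zero]
  exact ⟨(LinearEquiv.ofInjectiveEndo _ hinj).toContinuousLinearEquiv, by ext v; rfl⟩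

theorem pseudoinverse_apply_eq_iff {A : E →L[ℝ] F} (hA : Function.Injective A) (w : F) (v : E) :
    pseudoinverse A w = v ↔ adjoint A (A v) = adjoint A w := by
  obtain ⟨e, he⟩ := exists_equiv_adjoint_comp_self hA
  have h1 : adjoint A (A v) = e v := by
    rw [← ContinuousLinearEquiv.coe_coe, he]; rfl
  rw [pseudoinverse, ← he, ContinuousLinearMap.inverse_equiv, h1, ContinuousLinearMap.comp_apply,
    ContinuousLinearEquiv.coe_coe, ContinuousLinearEquiv.symm_apply_eq, eq_comm]

theorem contDiffAt_pseudoinverse {A : E →L[ℝ] F} (hA : Function.Injective A) :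
    ContDiffAt ℝ ∞ (pseudoinverse : (E →L[ℝ] F) → F →L[ℝ] E) A := by
  have hadj : ContDiff ℝ ∞ (fun A : E →L[ℝ] F => adjoint A) :=
    ((adjoint (𝕜 := ℝ) (E := E) (F := F)).toLinearEquiv.toAddEquiv.toAddMonoidHom.toRealLinearMap
      (adjoint (𝕜 := ℝ) (E := E) (F := F)).continuous).contDiff
  obtain ⟨e, he⟩ := exists_equiv_adjoint_comp_self hA
  have h1 : ContDiffAt ℝ ∞ (ContinuousLinearMap.inverse : (E →L[ℝ] E) → E →L[ℝ] E)
      (adjoint A ∘L A) := he ▸ contDiffAt_map_inverse e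
  have h2 : ContDiffAt ℝ ∞ (fun A : E →L[ℝ] F => adjoint A ∘L A) A :=
    (hadj.clm_comp contDiff_id).contDiffAt
  exact (ContDiffAt.comp (f := fun A : E →L[ℝ] F => adjoint A ∘L A) A h1 h2).clm_comp
    hadj.contDiffAt

end Pseudoinverse

section Manifold

variable (n : ℕ) (X : Type u) [TopologicalSpace X] [ChartedSpace (EuclideanSpace ℝ (Fin n)) X]
  [IsManifold (𝓡 n) ∞ X]

/-- Finitely many smooth functions `fn j` and smooth vector fields `field j` with
`v = ∑ j, d(fn j)(v) • field j` for all tangent vectors `v`. Smoothness of a vector field means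
smoothness of its coordinates in the trivializations of the tangent bundle. -/
structure DualFrame (ι : Type) [Fintype ι] where
  fn : ι → C^∞⟮𝓡 n, X; 𝓘(ℝ, ℝ), ℝ⟯
  field : ι → (x : X) → TangentSpace (𝓡 n) x
  sum_smul_field : ∀ (x : X) (v : TangentSpace (𝓡 n) x),
    ∑ j, mvfderiv (𝓡 n) (fn j) x v • field j x = v
  contMDiffAt_field : ∀ (j : ι) (x₀ : X), ContMDiffAt (𝓡 n) 𝓘(ℝ, EuclideanSpace ℝ (Fin n)) ∞
    (fun y => (trivializationAt (EuclideanSpace ℝ (Fin n)) (TangentSpace (𝓡 n)) x₀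
      ).continuousLinearMapAt ℝ y (field j y)) x₀

/-- The coordinates of an immersion `H`, and the vector fields given by the columns of the
pseudo-inverses of the differentials of `H`. -/
theorem exists_dualFrame [T2Space X] [SecondCountableTopology X] :
    Nonempty (DualFrame n X (Fin (n ^ 2 + 1))) := by
  obtain ⟨H, hH, hinj⟩ := exists_contMDiff_injective_mfderiv (n := n) (X := X)
  let D (y : X) : EuclideanSpace ℝ (Fin n) →L[ℝ] EuclideanSpace ℝ (Fin (n ^ 2 + 1)) :=
    mfderiv (𝓡 n) 𝓘(ℝ, EuclideanSpace ℝ (Fin (n ^ 2 + 1))) H y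
  let fn (j : Fin (n ^ 2 + 1)) : C^∞⟮𝓡 n, X; 𝓘(ℝ, ℝ), ℝ⟯ :=
    ⟨fun x => H x j, (EuclideanSpace.proj (𝕜 := ℝ) j).contMDiff.comp hH⟩
  have hfn (j) (x : X) (v : TangentSpace (𝓡 n) x) : mvfderiv (𝓡 n) (fn j) x v = D x v j := by
    have h1 : mfderiv (𝓡 n) 𝓘(ℝ, ℝ) (fn j) x = (EuclideanSpace.proj (𝕜 := ℝ) j) ∘L D x := by
      have h2 : HasMFDerivAt 𝓘(ℝ, EuclideanSpace ℝ (Fin (n ^ 2 + 1))) 𝓘(ℝ, ℝ)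
          (EuclideanSpace.proj (𝕜 := ℝ) j) (H x) (EuclideanSpace.proj (𝕜 := ℝ) j) :=
        (EuclideanSpace.proj (𝕜 := ℝ) j).hasFDerivAt.hasMFDerivAt
      exact (h2.comp x (hH.mdifferentiableAt (by simp)).hasMFDerivAt).mfderiv
    change mfderiv (𝓡 n) 𝓘(ℝ, ℝ) (fn j) x v = _
    rw [h1]
    rfl
  refine ⟨⟨fn, fun j x => pseudoinverse (D x) (EuclideanSpace.single j 1), fun x v => ?_,
    fun j x₀ => ?_⟩⟩
  · have h1 : ∑ j, D x v j • EuclideanSpace.single j (1 : ℝ) = D x v := by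
      simpa using (EuclideanSpace.basisFun _ ℝ).sum_repr (D x v)
    have h2 : pseudoinverse (D x) (D x v) = v := (pseudoinverse_apply_eq_iff (hinj x) _ _).2 rfl
    simp only [hfn]
    conv_rhs => rw [← h2, ← h1, map_sum]
    simp only [map_smul]
    rfl
  · let e := trivializationAt (EuclideanSpace ℝ (Fin n)) (TangentSpace (𝓡 n) (M := X)) x₀
    let S (y : X) : EuclideanSpace ℝ (Fin n) →L[ℝ] EuclideanSpace ℝ (Fin n) := e.symmL ℝ y
    have hSD : ContMDiffAt (𝓡 n) 𝓘(ℝ, EuclideanSpace ℝ (Fin n) →L[ℝ]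
        EuclideanSpace ℝ (Fin (n ^ 2 + 1))) ∞ (fun y => D y ∘L S y) x₀ := by
      have hg : ContMDiffAt (𝓡 n) 𝓘(ℝ, EuclideanSpace ℝ (Fin n) →L[ℝ]
          EuclideanSpace ℝ (Fin (n ^ 2 + 1))) ∞
          (inTangentCoordinates (𝓡 n) 𝓘(ℝ, EuclideanSpace ℝ (Fin (n ^ 2 + 1))) id H
            (fun x => mfderiv (𝓡 n) 𝓘(ℝ, EuclideanSpace ℝ (Fin (n ^ 2 + 1))) H x) x₀) x₀ :=
        (hH.contMDiffAt (x := x₀)).mfderiv_const (m := ∞) le_rfl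
      refine hg.congr_of_eventuallyEq (Filter.Eventually.of_forall fun y => ?_)
      ext1 v
      simp only [inTangentCoordinates, ContinuousLinearMap.inCoordinates]
      erw [TangentBundle.continuousLinearMapAt_model_space]
      rfl
    have hSy {y : X} (hy : y ∈ e.baseSet) : Function.Injective (S y) := by
      refine Function.LeftInverse.injective (g := e.continuousLinearMapAt ℝ y) fun v => ?_
      exact e.continuousLinearMapAt_symmL hy v
    have hx₀ : x₀ ∈ e.baseSet := FiberBundle.mem_baseSet_trivializationAt' x₀
    have hDS {y : X} (hy : y ∈ e.baseSet) : Function.Injective (D y ∘L S y) :=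
      (show Function.Injective (D y) from hinj y).comp (hSy hy)
    have hsm : ContMDiffAt (𝓡 n) 𝓘(ℝ, EuclideanSpace ℝ (Fin n)) ∞
        (fun y => pseudoinverse (D y ∘L S y) (EuclideanSpace.single j 1)) x₀ := by
      have h1 := (contDiffAt_pseudoinverse (hDS hx₀)).contMDiffAt.comp x₀ hSD
      exact h1.clm_apply contMDiffAt_const
    refine hsm.congr_of_eventuallyEq ?_
    filter_upwards [e.open_baseSet.mem_nhds hx₀] with y hy
    symm
    refine (pseudoinverse_apply_eq_iff (hDS hy) _ _).2 ?_
    have h1 : S y (e.continuousLinearMapAt ℝ y (pseudoinverse (D y) (EuclideanSpace.single j 1))) =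
        pseudoinverse (D y) (EuclideanSpace.single j 1) := e.symmL_continuousLinearMapAt hy _
    rw [ContinuousLinearMap.adjoint_comp, ContinuousLinearMap.comp_apply,
      ContinuousLinearMap.comp_apply, ContinuousLinearMap.comp_apply]
    erw [h1]
    rw [(pseudoinverse_apply_eq_iff (show Function.Injective (D y) from hinj y) _ _).1 rfl]

end Manifold

/-! ### Differential forms in a dual frame -/

section Manifold

variable {n : ℕ} {X : Type u} [TopologicalSpace X] [ChartedSpace (EuclideanSpace ℝ (Fin n)) X]

/-- The derivative of smooth functions along a tangent vector `v` at `p`. -/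
def derivAlong (p : X) (v : TangentSpace (𝓡 n) p) : C^∞⟮𝓡 n, X; 𝓘(ℝ, ℝ), ℝ⟯ →ₗ[ℝ] ℝ where
  toFun g := mvfderiv (𝓡 n) g p v
  map_add' g h := by
    have := mvfderiv_add (I := 𝓡 n) (g.contMDiff.mdifferentiableAt (x := p) (by simp))
      (h.contMDiff.mdifferentiableAt (by simp))
    exact DFunLike.congr_fun this v
  map_smul' r g := by
    have := mvfderiv_smul (I := 𝓡 n) (a := fun _ : X => r) mdifferentiableAt_const
      (g.contMDiff.mdifferentiableAt (x := p) (by simp))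
    have h := DFunLike.congr_fun this v
    simpa [mvfderiv_const] using! h

theorem derivAlong_mul (p : X) (v : TangentSpace (𝓡 n) p) (g h : C^∞⟮𝓡 n, X; 𝓘(ℝ, ℝ), ℝ⟯) :
    derivAlong p v (g * h) = g p * derivAlong p v h + h p * derivAlong p v g := by
  have := mvfderiv_mul (I := 𝓡 n) (g.contMDiff.mdifferentiableAt (x := p) (by simp))
    (h.contMDiff.mdifferentiableAt (by simp))
  exact DFunLike.congr_fun this v

theorem derivAlong_algebraMap (p : X) (v : TangentSpace (𝓡 n) p) (r : ℝ) :
    derivAlong p v (algebraMap ℝ _ r) = 0 :=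
  DFunLike.congr_fun (mvfderiv_const (I := 𝓡 n) r) v

end Manifold

section Smooth

variable {n : ℕ} {X : Type u} [TopologicalSpace X] [ChartedSpace (EuclideanSpace ℝ (Fin n)) X]
variable {A : Type*} [Ring A] [Algebra ℝ A] [Module.Finite ℝ A]

/-- Smoothness of functions with values in a finite-dimensional algebra, tested on linear forms:
this avoids the choice of a norm on the algebra. -/
theorem contMDiffAt_dual_mul {x₀ : X} {α β : X → A}
    (hα : ∀ l : Module.Dual ℝ A, ContMDiffAt (𝓡 n) 𝓘(ℝ, ℝ) ∞ (fun y => l (α y)) x₀)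
    (hβ : ∀ l : Module.Dual ℝ A, ContMDiffAt (𝓡 n) 𝓘(ℝ, ℝ) ∞ (fun y => l (β y)) x₀)
    (l : Module.Dual ℝ A) : ContMDiffAt (𝓡 n) 𝓘(ℝ, ℝ) ∞ (fun y => l (α y * β y)) x₀ := by
  let b := Module.finBasis ℝ A
  have h : (fun y => l (α y * β y)) = fun y => ∑ i, ∑ j,
      (b.coord i (α y) * b.coord j (β y)) * l (b i * b j) := by
    funext y
    conv_lhs => rw [← b.sum_repr (α y), ← b.sum_repr (β y)]
    simp only [Finset.sum_mul_sum, map_sum, smul_mul_smul_comm, map_smul, smul_eq_mul,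
      Module.Basis.coord_apply]
  rw [h]
  exact ContMDiffAt.sum fun i _ => ContMDiffAt.sum fun j _ =>
    ((hα _).mul (hβ _)).mul contMDiffAt_const

theorem finite_exteriorAlgebra (V : Type*) [AddCommGroup V] [Module ℝ V] [Module.Finite ℝ V] :
    Module.Finite ℝ (ExteriorAlgebra ℝ V) :=
  Module.Finite.of_basis (Module.finBasis ℝ V).ExteriorAlgebra

theorem contMDiffAt_dual_map {V W : Type*} [AddCommGroup V] [Module ℝ V] [Module.Finite ℝ V]
    [AddCommGroup W] [Module ℝ W] [Module.Finite ℝ W] {x₀ : X} {Z : X → V →ₗ[ℝ] W}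
    {β : X → ExteriorAlgebra ℝ V}
    (hZ : ∀ (v : V) (l : Module.Dual ℝ W), ContMDiffAt (𝓡 n) 𝓘(ℝ, ℝ) ∞ (fun y => l (Z y v)) x₀)
    (hβ : ∀ l : Module.Dual ℝ (ExteriorAlgebra ℝ V),
      ContMDiffAt (𝓡 n) 𝓘(ℝ, ℝ) ∞ (fun y => l (β y)) x₀)
    (l : Module.Dual ℝ (ExteriorAlgebra ℝ W)) :
    ContMDiffAt (𝓡 n) 𝓘(ℝ, ℝ) ∞ (fun y => l (ExteriorAlgebra.map (Z y) (β y))) x₀ := by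
  have := finite_exteriorAlgebra V
  have := finite_exteriorAlgebra W
  have hconst (a : ExteriorAlgebra ℝ V) : ∀ l : Module.Dual ℝ (ExteriorAlgebra ℝ W),
      ContMDiffAt (𝓡 n) 𝓘(ℝ, ℝ) ∞ (fun y => l (ExteriorAlgebra.map (Z y) a)) x₀ := by
    induction a using ExteriorAlgebra.induction with
    | algebraMap r => intro l; simpa only [AlgHom.commutes] using contMDiffAt_const
    | ι v =>
      intro l
      simpa only [ExteriorAlgebra.map_apply_ι] using! hZ v (l ∘ₗ ExteriorAlgebra.ι ℝ)
    | mul a b ha hb =>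
      intro l
      simp only [map_mul]
      exact contMDiffAt_dual_mul ha hb l
    | add a b ha hb =>
      intro l
      simp only [map_add]
      exact (ha l).add (hb l)
  let b := Module.finBasis ℝ (ExteriorAlgebra ℝ V)
  have h : (fun y => l (ExteriorAlgebra.map (Z y) (β y))) = fun y => ∑ i,
      b.coord i (β y) * l (ExteriorAlgebra.map (Z y) (b i)) := by
    funext y
    conv_lhs => rw [← b.sum_repr (β y)]
    simp only [map_sum, map_smul, smul_eq_mul, Module.Basis.coord_apply]
  rw [h]
  exact ContMDiffAt.sum fun i _ => (hβ _).mul (hconst _ _)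

end Smooth

namespace DualFrame

variable {n : ℕ} {X : Type u} [TopologicalSpace X] [ChartedSpace (EuclideanSpace ℝ (Fin n)) X]
  [IsManifold (𝓡 n) ∞ X] {ι : Type} [Fintype ι] (Φ : DualFrame n X ι)

/-- The values of a covector on the vector fields of the frame. -/
def coordMap (x : X) : Module.Dual ℝ (TangentSpace (𝓡 n) x) →ₗ[ℝ] ι → ℝ :=
  LinearMap.pi fun j => Module.Dual.eval ℝ _ (Φ.field j x)

/-- The algebra morphism `Λ T*_x X → Λ ℝ^ι` given by `coordMap`. -/
def toExt (x : X) : FormsAt n x →ₐ[ℝ] ExteriorAlgebra ℝ (ι → ℝ) :=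
  ExteriorAlgebra.map (Φ.coordMap x)

theorem contMDiff_toExt (α : formAlgebra n X) (l : Module.Dual ℝ (ExteriorAlgebra ℝ (ι → ℝ))) :
    ContMDiff (𝓡 n) 𝓘(ℝ, ℝ) ∞ (fun x => l (Φ.toExt x (α.1 x))) := by
  intro x₀
  let e := trivializationAt (EuclideanSpace ℝ (Fin n)) (TangentSpace (𝓡 n) (M := X)) x₀
  let Z (y : X) : Module.Dual ℝ (EuclideanSpace ℝ (Fin n)) →ₗ[ℝ] ι → ℝ :=
    LinearMap.pi fun j => Module.Dual.eval ℝ _ (e.continuousLinearMapAt ℝ y (Φ.field j y))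
  have hx₀ : x₀ ∈ e.baseSet := FiberBundle.mem_baseSet_trivializationAt' x₀
  have hZ (v) (l : Module.Dual ℝ (ι → ℝ)) :
      ContMDiffAt (𝓡 n) 𝓘(ℝ, ℝ) ∞ (fun y => l (Z y v)) x₀ := by
    classical
    have h1 : (fun y => l (Z y v)) = fun y => ∑ j,
        LinearMap.toContinuousLinearMap v (e.continuousLinearMapAt ℝ y (Φ.field j y)) *
          l (Pi.single j 1) := by
      funext y
      conv_lhs => rw [pi_eq_sum_univ (Z y v), map_sum]
      refine Finset.sum_congr rfl fun j _ => ?_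
      rw [map_smul, smul_eq_mul]
      congr 2
      ext i
      simp [Pi.single_apply, eq_comm]
    rw [h1]
    exact ContMDiffAt.sum fun j _ => ((LinearMap.toContinuousLinearMap v).contMDiff.contMDiffAt.comp
      x₀ (Φ.contMDiffAt_field j x₀)).mul contMDiffAt_const
  refine (contMDiffAt_dual_map hZ (α.2 x₀) l).congr_of_eventuallyEq ?_
  filter_upwards [e.open_baseSet.mem_nhds hx₀] with y hy
  congr 1
  have h1 : Φ.toExt y = (ExteriorAlgebra.map (Z y)).comp (inCoord n x₀ y) := by
    rw [toExt, inCoord, ExteriorAlgebra.map_comp_map]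
    congr 1
    ext φ j
    change φ (Φ.field j y) = φ (e.symmL ℝ y (e.continuousLinearMapAt ℝ y (Φ.field j y)))
    rw [e.symmL_continuousLinearMapAt hy]
  rw [h1]
  rfl

/-- The coefficient, with respect to a linear form `l` on `Λ ℝ^ι`, of a differential form expressed
in the frame. -/
def coef (l : Module.Dual ℝ (ExteriorAlgebra ℝ (ι → ℝ))) (α : formAlgebra n X) :
    C^∞⟮𝓡 n, X; 𝓘(ℝ, ℝ), ℝ⟯ :=
  ⟨fun x => l (Φ.toExt x (α.1 x)), Φ.contMDiff_toExt α l⟩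

theorem toExt_ι (x : X) (φ : Module.Dual ℝ (TangentSpace (𝓡 n) x)) :
    Φ.toExt x (ExteriorAlgebra.ι ℝ φ) = ExteriorAlgebra.ι ℝ (Φ.coordMap x φ) :=
  ExteriorAlgebra.map_apply_ι _ _

/-- The derivation of `C^∞(X)` given by a vector field of the frame. -/
def fieldDeriv (j : ι) :
    Derivation ℝ C^∞⟮𝓡 n, X; 𝓘(ℝ, ℝ), ℝ⟯ C^∞⟮𝓡 n, X; 𝓘(ℝ, ℝ), ℝ⟯ :=
  Derivation.mk'
    { toFun g := ⟨fun x => derivAlong x (Φ.field j x) g, by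
        refine (Φ.contMDiff_toExt (differential g)
          ((LinearMap.proj j : (ι → ℝ) →ₗ[ℝ] ℝ) ∘ₗ ExteriorAlgebra.ιInv)).congr fun x => ?_
        change _ = (LinearMap.proj j : (ι → ℝ) →ₗ[ℝ] ℝ)
          (ExteriorAlgebra.ιInv (Φ.toExt x (ExteriorAlgebra.ι ℝ _)))
        rw [toExt_ι, ExteriorAlgebra.ι_leftInverse]
        rfl⟩
      map_add' g h := ContMDiffMap.ext fun x => map_add (derivAlong x (Φ.field j x)) g h
      map_smul' r g := ContMDiffMap.ext fun x => map_smul (derivAlong x (Φ.field j x)) r g }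
    (fun g h => ContMDiffMap.ext fun x => derivAlong_mul x (Φ.field j x) g h)

theorem fieldDeriv_apply (j : ι) (g : C^∞⟮𝓡 n, X; 𝓘(ℝ, ℝ), ℝ⟯) (x : X) :
    Φ.fieldDeriv j g x = mvfderiv (𝓡 n) g x (Φ.field j x) := rfl

/-- The defining identity of the frame, for covectors: `dg = ∑ j, Y_j(g) d(fn j)`. -/
theorem mvfderiv_eq_sum (g : C^∞⟮𝓡 n, X; 𝓘(ℝ, ℝ), ℝ⟯) (x : X) (v : TangentSpace (𝓡 n) x) :
    mvfderiv (𝓡 n) g x v = ∑ j, Φ.fieldDeriv j g x * mvfderiv (𝓡 n) (Φ.fn j) x v := by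
  conv_lhs => rw [← Φ.sum_smul_field x v, map_sum]
  refine Finset.sum_congr rfl fun j _ => ?_
  rw [map_smul, smul_eq_mul, mul_comm, fieldDeriv_apply]

theorem fieldDeriv_eq_sum (i : ι) (g : C^∞⟮𝓡 n, X; 𝓘(ℝ, ℝ), ℝ⟯) :
    Φ.fieldDeriv i g = ∑ j, Φ.fieldDeriv j g * Φ.fieldDeriv i (Φ.fn j) :=
  ContMDiffMap.ext fun x => by
    rw [← evalPoint_apply x (∑ j, _), map_sum]
    exact Φ.mvfderiv_eq_sum g x (Φ.field i x)

theorem sub_linear_mem_pointIdeal_sq [T2Space X] (p : X) (g : C^∞⟮𝓡 n, X; 𝓘(ℝ, ℝ), ℝ⟯) :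
    ∃ (r : ℝ) (c : ι → ℝ), g - algebraMap ℝ _ r - ∑ j, c j • Φ.fn j ∈ pointIdeal (n := n) p ^ 2 ∧
      ∀ j, Φ.fieldDeriv j g - algebraMap ℝ _ (c j) ∈ pointIdeal (n := n) p := by
  let c (j : ι) : ℝ := Φ.fieldDeriv j g p
  refine ⟨g p - ∑ j, c j * Φ.fn j p, c, mem_pointIdeal_sq ?_ ?_, fun j => ?_⟩
  · rw [← evalPoint_apply]
    simp only [map_sub _ (_ - _), map_sub _ g, AlgHom.commutes, map_sum _ (fun j => c j • Φ.fn j),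
      map_smul, evalPoint_apply, smul_eq_mul, Algebra.algebraMap_self_apply]
    ring
  · ext v
    change derivAlong p v (_ - _ - _) = 0
    rw [map_sub, map_sub, derivAlong_algebraMap, map_sum]
    simp only [map_smul, smul_eq_mul]
    have := Φ.mvfderiv_eq_sum g p v
    change derivAlong p v g = _ at this
    rw [this, sub_zero, sub_eq_zero]
    rfl
  · rw [RingHom.mem_ker, map_sub, AlgHom.commutes]
    exact sub_self _

end DualFrame

/-! ### Odd derivations into geometric superalgebras -/

section Geometric

variable {A : SuperAlg.{u}}

theorem even_mul_even {a b : A} (ha : a ∈ A.even) (hb : b ∈ A.even) : a * b ∈ A.even := by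
  simpa using SetLike.mul_mem_graded ha hb

theorem even_mul_odd {a b : A} (ha : a ∈ A.even) (hb : b ∈ A.odd) : a * b ∈ A.odd := by
  simpa using SetLike.mul_mem_graded ha hb

theorem odd_mul_even {a b : A} (ha : a ∈ A.odd) (hb : b ∈ A.even) : a * b ∈ A.odd := by
  simpa using SetLike.mul_mem_graded ha hb

theorem odd_mul_odd {a b : A} (ha : a ∈ A.odd) (hb : b ∈ A.odd) : a * b ∈ A.even :=
  SetLike.mul_mem_graded ha hb

theorem one_mem_even : (1 : A) ∈ A.even := SetLike.GradedOne.one_mem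

theorem even_pow {a : A} (ha : a ∈ A.even) (k : ℕ) : a ^ k ∈ A.even := by
  induction k with
  | zero => simpa using one_mem_even
  | succ k ih => rw [pow_succ]; exact even_mul_even ih ha

/-- The even components of the elements of the ideal generated by the odd part are nilpotent. -/
theorem exists_isNilpotent_add_odd {y : A} (hy : y ∈ oddIdeal A) :
    ∃ b ∈ A.even, ∃ c ∈ A.odd, y = b + c ∧ IsNilpotent b := by
  induction hy using Submodule.span_induction with
  | mem x hx => exact ⟨0, zero_mem _, x, hx, by simp, IsNilpotent.zero⟩
  | zero => exact ⟨0, zero_mem _, 0, zero_mem _, by simp, IsNilpotent.zero⟩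
  | add x y _ _ hx hy =>
    obtain ⟨b, hb, c, hc, rfl, hn⟩ := hx
    obtain ⟨b', hb', c', hc', rfl, hn'⟩ := hy
    exact ⟨b + b', add_mem hb hb', c + c', add_mem hc hc', by abel,
      Commute.isNilpotent_add (even_comm hb b') hn hn'⟩
  | smul a x _ hx =>
    obtain ⟨b, hb, c, hc, rfl, hn⟩ := hx
    obtain ⟨a, ha, d, hd, rfl⟩ := exists_add a
    refine ⟨a * b + d * c, add_mem (even_mul_even ha hb) (odd_mul_odd hd hc), a * c + d * b,
      add_mem (even_mul_odd ha hc) (odd_mul_even hd hb), by rw [smul_eq_mul]; noncomm_ring, ?_⟩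
    refine Commute.isNilpotent_add (even_comm (even_mul_even ha hb) _)
      (Commute.isNilpotent_mul_left (even_comm ha b) hn) ⟨2, ?_⟩
    -- the square of a product of two odd elements is zero
    rw [pow_two, mul_assoc, ← mul_assoc c, odd_anticomm hc hd, neg_mul, mul_assoc, odd_mul_self hc]
    simp

theorem isNilpotent_of_mem_oddIdeal {y : A} (hy : y ∈ oddIdeal A) (he : y ∈ A.even) :
    IsNilpotent y := by
  obtain ⟨b, hb, c, hc, rfl, hn⟩ := exists_isNilpotent_add_odd hy
  have h0 : c = 0 := by
    have h1 : c ∈ A.even := by simpa using sub_mem he hb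
    exact Submodule.disjoint_def.1 (isCompl_even_odd A).disjoint c h1 hc
  rwa [h0, add_zero]

/-- Odd derivations over `f₀ : R → A` are determined by their values on the `h j` when `A` is
smoothly closed geometric. At each real point `x` of the heart, the values are considered in `V =
A¹ / ker(x) A¹`. There, an element `g` of the kernel of `χ = x ∘ f₀` acts nilpotently: `f₀ g`
differs by a nilpotent element from a representative of its class in `|A|`, which acts as an
element of `ker(x)`. So `derivation_eq_sum` gives the identity modulo `ker(x) A¹`, and the
intersection of these submodules is zero. -/
theorem odd_derivation_eq_sum (hA : IsSCG A) {R : Type*} [CommRing R] [Algebra ℝ R]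
    (f₀ : R →ₐ[ℝ] A) (h₀ : ∀ g, f₀ g ∈ A.even) (f₁ : R →ₗ[ℝ] A) (h₁ : ∀ g, f₁ g ∈ A.odd)
    (hmul : ∀ g h, f₁ (g * h) = f₁ g * f₀ h + f₀ g * f₁ h) {ι : Type*} [Fintype ι]
    (h : ι → R) (Y : ι → Derivation ℝ R R) (hY : ∀ i g, Y i g = ∑ j, Y j g * Y i (h j))
    (hfg : ∀ χ : R →ₐ[ℝ] ℝ, (RingHom.ker χ).FG)
    (hm : ∀ (χ : R →ₐ[ℝ] ℝ) (g : R), ∃ (r : ℝ) (c : ι → ℝ),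
      g - algebraMap ℝ R r - ∑ j, c j • h j ∈ RingHom.ker χ ^ 2 ∧
      ∀ j, Y j g - algebraMap ℝ R (c j) ∈ RingHom.ker χ) (g : R) :
    f₁ g = ∑ j, f₀ (Y j g) * f₁ (h j) := by
  obtain ⟨-, modH, -, hrep, hgeo⟩ := hA
  let modR : Module R A.odd :=
    { smul g m := ⟨f₀ g * m, even_mul_odd (h₀ g) m.2⟩
      one_smul m := Subtype.ext (by change f₀ 1 * (m : A) = m; simp)
      mul_smul a b m := Subtype.ext (by
        change f₀ (a * b) * (m : A) = f₀ a * (f₀ b * m); rw [map_mul, mul_assoc])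
      smul_zero a := Subtype.ext (by change f₀ a * (0 : A) = 0; simp)
      smul_add a m m' := Subtype.ext (by
        change f₀ a * ((m : A) + m') = f₀ a * m + f₀ a * m'; rw [mul_add])
      add_smul a b m := Subtype.ext (by
        change f₀ (a + b) * (m : A) = f₀ a * m + f₀ b * m; rw [map_add, add_mul])
      zero_smul m := Subtype.ext (by change f₀ 0 * (m : A) = 0; simp) }
  have hsmul (a : R) (m : A.odd) : ((a • m : A.odd) : A) = f₀ a * m := rfl
  have tow : IsScalarTower ℝ R A.odd := ⟨fun r a m => Subtype.ext (by
    rw [hsmul, map_smul, smul_mul_assoc]; rfl)⟩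
  let d (g : R) : A.odd := ⟨f₁ g, h₁ g⟩
  let s (g : R) : A.odd := ∑ j, Y j g • d (h j)
  suffices hs : d g - s g ∈
      ⨅ x : Heart A →ₐ[ℝ] ℝ, RingHom.ker x • (⊤ : Submodule (Heart A) A.odd) by
    rw [hgeo, Submodule.mem_bot, sub_eq_zero] at hs
    have := congrArg Subtype.val hs
    simpa only [s, Submodule.coe_sum, hsmul] using this
  refine (Submodule.mem_iInf _).2 fun x => ?_
  let χ : R →ₐ[ℝ] ℝ := x.comp ((Ideal.Quotient.mkₐ ℝ (oddIdeal A)).comp f₀)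
  -- `K = ker(x) A¹` is stable under multiplication by even elements
  let K : Submodule (Heart A) A.odd := RingHom.ker x • ⊤
  have hK (a : A) (ha : a ∈ A.even) (m : A.odd) (hmK : m ∈ K) :
      (⟨a * m, even_mul_odd ha m.2⟩ : A.odd) ∈ K := by
    induction hmK using Submodule.smul_induction_on' with
    | smul b hb m hm =>
      have e : (⟨a * (b • m : A.odd), even_mul_odd ha (b • m).2⟩ : A.odd) =
          b • ⟨a * m, even_mul_odd ha m.2⟩ := by
        obtain ⟨a', ha', -, hact⟩ := hrep b
        refine Subtype.ext ?_
        change a * ((b • m : A.odd) : A) = _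
        rw [hact, hact]
        change a * (a' * (m : A)) = a' * (a * m)
        rw [← mul_assoc, ← mul_assoc, even_comm ha]
      rw [e]
      exact Submodule.smul_mem_smul hb trivial
    | add m _ m' _ hm hm' =>
      have e : (⟨a * (m + m' : A.odd), even_mul_odd ha (m + m').2⟩ : A.odd) =
          ⟨a * m, even_mul_odd ha m.2⟩ + ⟨a * m', even_mul_odd ha m'.2⟩ :=
        Subtype.ext (mul_add a (m : A) m')
      rw [e]
      exact add_mem hm hm'
  let K' : Submodule R A.odd :=
    { K.toAddSubmonoid with smul_mem' := fun a m hm => hK (f₀ a) (h₀ a) m hm }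
  let D : Derivation ℝ R (A.odd ⧸ K') := Derivation.mk'
    { toFun g := K'.mkQ (d g)
      map_add' a b := by rw [← map_add]; exact congrArg _ (Subtype.ext (map_add f₁ a b))
      map_smul' r a := by
        rw [RingHom.id_apply, ← algebraMap_smul R r (K'.mkQ (d a)), ← map_smul, algebraMap_smul]
        exact congrArg _ (Subtype.ext (map_smul f₁ r a)) }
    (fun a b => by
      change K'.mkQ (d (a * b)) = a • K'.mkQ (d b) + b • K'.mkQ (d a)
      rw [← map_smul, ← map_smul, ← map_add]
      refine congrArg _ (Subtype.ext ?_)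
      change f₁ (a * b) = f₀ a * f₁ b + f₀ b * f₁ a
      rw [hmul, even_comm (h₀ b), add_comm])
  have hnil : ∀ a ∈ RingHom.ker χ, ∃ k : ℕ, ∀ v : A.odd ⧸ K', a ^ k • v = 0 := by
    intro a ha
    obtain ⟨a', ha', hq, hact⟩ := hrep (Ideal.Quotient.mk (oddIdeal A) (f₀ a))
    have hνe : f₀ a - a' ∈ A.even := sub_mem (h₀ a) ha'
    obtain ⟨k, hk⟩ := isNilpotent_of_mem_oddIdeal (Ideal.Quotient.eq.1 hq.symm) hνe
    -- modulo `K'`, the element `a` acts as the nilpotent element `f₀ a - a'`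
    have key (m : A.odd) : ∀ j : ℕ,
        a ^ j • m - ⟨(f₀ a - a') ^ j * m, even_mul_odd (even_pow hνe j) m.2⟩ ∈ K' := by
      intro j
      induction j with
      | zero =>
        convert! K'.zero_mem
        rw [sub_eq_zero]
        exact Subtype.ext (by rw [hsmul]; simp)
      | succ j ih =>
        let m' : A.odd := ⟨(f₀ a - a') ^ j * m, even_mul_odd (even_pow hνe j) m.2⟩
        have e : a ^ (j + 1) • m - (⟨(f₀ a - a') ^ (j + 1) * m,
            even_mul_odd (even_pow hνe (j + 1)) m.2⟩ : A.odd) =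
            a • (a ^ j • m - m') + (Ideal.Quotient.mk (oddIdeal A) (f₀ a) : Heart A) • m' := by
          refine Subtype.ext ?_
          rw [Submodule.coe_add, hact, smul_sub, smul_smul, ← pow_succ']
          change f₀ (a ^ (j + 1)) * (m : A) - (f₀ a - a') ^ (j + 1) * m =
            f₀ (a ^ (j + 1)) * (m : A) - f₀ a * ((f₀ a - a') ^ j * m) + a' * ((f₀ a - a') ^ j * m)
          rw [pow_succ' (f₀ a - a'), mul_assoc, sub_mul]
          abel
        rw [e]
        exact add_mem (K'.smul_mem _ ih) (Submodule.smul_mem_smul (show _ ∈ RingHom.ker x from ha)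
          trivial : _ ∈ K)
    refine ⟨k, fun v => ?_⟩
    obtain ⟨m, rfl⟩ := K'.mkQ_surjective v
    rw [← map_smul]
    have h2 := key m k
    rw [← K'.ker_mkQ, LinearMap.mem_ker, map_sub, sub_eq_zero] at h2
    rw [h2]
    have h3 : (⟨(f₀ a - a') ^ k * m, even_mul_odd (even_pow hνe k) m.2⟩ : A.odd) = 0 :=
      Subtype.ext (by change (f₀ a - a') ^ k * (m : A) = 0; rw [hk, zero_mul])
    rw [h3, map_zero]
  have hD := derivation_eq_sum (RingHom.ker χ) (hfg χ) hnil D h Y hY (hm χ) g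
  have h4 : K'.mkQ (d g) = K'.mkQ (s g) := by
    rw [map_sum]
    simp only [map_smul]
    exact hD
  have h5 : d g - s g ∈ K' := by
    rw [← K'.ker_mkQ, LinearMap.mem_ker, map_sub, sub_eq_zero, h4]
  exact h5

end Geometric

/-! ### Extension of morphisms from functions to differential forms -/

section Exterior

variable {A : SuperAlg.{u}} {ι : Type} [Fintype ι]

/-- The algebra morphism `Λ ℝ^ι → A` that sends the basis vectors of `ℝ^ι` to given odd elements. -/
def oddLift (θ : ι → A.odd) : ExteriorAlgebra ℝ (ι → ℝ) →ₐ[ℝ] A :=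
  ExteriorAlgebra.lift ℝ ⟨A.odd.subtype ∘ₗ Fintype.linearCombination ℝ θ, fun v =>
    odd_mul_self (Fintype.linearCombination ℝ θ v).2⟩

theorem oddLift_ι (θ : ι → A.odd) (v : ι → ℝ) :
    oddLift θ (ExteriorAlgebra.ι ℝ v) = Fintype.linearCombination ℝ θ v := by
  rw [oddLift, ExteriorAlgebra.lift_ι_apply]; rfl

theorem oddLift_ι_single [DecidableEq ι] (θ : ι → A.odd) (j : ι) :
    oddLift θ (ExteriorAlgebra.ι ℝ (Pi.single j 1)) = θ j := by
  rw [oddLift_ι, Fintype.linearCombination_apply_single, one_smul]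

theorem oddLift_mem (θ : ι → A.odd) (i : ZMod 2) {w : ExteriorAlgebra ℝ (ι → ℝ)}
    (hw : w ∈ CliffordAlgebra.evenOdd (0 : QuadraticForm ℝ (ι → ℝ)) i) :
    oddLift θ w ∈ A.grading i := by
  have hι (v : ι → ℝ) : oddLift θ (CliffordAlgebra.ι (0 : QuadraticForm ℝ (ι → ℝ)) v) ∈ A.odd := by
    have := oddLift_ι θ v
    change oddLift θ (CliffordAlgebra.ι (0 : QuadraticForm ℝ (ι → ℝ)) v) = _ at this
    rw [this]
    exact (Fintype.linearCombination ℝ θ v).2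
  rcases zmod_two_cases i with rfl | rfl
  · induction w, hw using CliffordAlgebra.even_induction with
    | algebraMap r =>
      have h := A.even.smul_mem r (one_mem_even (A := A))
      rw [← Algebra.algebraMap_eq_smul_one] at h
      exact ((oddLift θ).commutes r).symm ▸ h
    | add x y _ _ hx hy => exact (map_add (oddLift θ) x y).symm ▸ add_mem hx hy
    | ι_mul_ι_mul v w x _ hx =>
      have h := even_mul_even (odd_mul_odd (hι v) (hι w)) hx
      rw [← map_mul, ← map_mul] at h
      exact h
  · induction w, hw using CliffordAlgebra.odd_induction with
    | ι v => exact hι v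
    | add x y _ _ hx hy => exact (map_add (oddLift θ) x y).symm ▸ add_mem hx hy
    | ι_mul_ι_mul v w x _ hx =>
      have h := even_mul_odd (odd_mul_odd (hι v) (hι w)) hx
      rw [← map_mul, ← map_mul] at h
      exact h

/-- The projection of an exterior algebra on its homogeneous part of degree `i` modulo `2`. -/
def extPart (V : Type) [AddCommGroup V] [Module ℝ V] (i : ZMod 2) :
    ExteriorAlgebra ℝ V →ₗ[ℝ] ExteriorAlgebra ℝ V :=
  if i = 0 then extEvenPart V else LinearMap.id - extEvenPart V

variable {V : Type} [AddCommGroup V] [Module ℝ V]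

theorem extPart_mem (i : ZMod 2) (a : ExteriorAlgebra ℝ V) :
    extPart V i a ∈ CliffordAlgebra.evenOdd (0 : QuadraticForm ℝ V) i := by
  rcases zmod_two_cases i with rfl | rfl
  · exact (extEvenPart_mem a).1
  · exact (extEvenPart_mem a).2

theorem extPart_eq_self {i : ZMod 2} {a : ExteriorAlgebra ℝ V}
    (ha : a ∈ CliffordAlgebra.evenOdd (0 : QuadraticForm ℝ V) i) : extPart V i a = a := by
  have hd := (CliffordAlgebra.evenOdd_isCompl (0 : QuadraticForm ℝ V)).disjoint
  have h := extEvenPart_mem a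
  rcases zmod_two_cases i with rfl | rfl
  · exact (sub_eq_zero.1 (Submodule.disjoint_def.1 hd _ (sub_mem ha h.1) h.2)).symm
  · have h1 : extEvenPart V a = 0 :=
      Submodule.disjoint_def.1 hd _ h.1 (by simpa using sub_mem ha h.2)
    change a - extEvenPart V a = a
    rw [h1, sub_zero]

theorem map_extPart {W : Type} [AddCommGroup W] [Module ℝ W] (f : V →ₗ[ℝ] W) (i : ZMod 2)
    (a : ExteriorAlgebra ℝ V) :
    ExteriorAlgebra.map f (extPart V i a) = extPart W i (ExteriorAlgebra.map f a) := by
  rcases zmod_two_cases i with rfl | rfl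
  · exact map_extEvenPart f a
  · change ExteriorAlgebra.map f (a - extEvenPart V a) = _ - extEvenPart W _
    rw [map_sub, map_extEvenPart]
    rfl

end Exterior

section Manifold

variable {n : ℕ} {X : Type u} [TopologicalSpace X] [ChartedSpace (EuclideanSpace ℝ (Fin n)) X]
  [IsManifold (𝓡 n) ∞ X]

variable (n X) in
/-- The inclusion of smooth functions as differential forms of degree `0`. -/
def ofFunctionHom : C^∞⟮𝓡 n, X; 𝓘(ℝ, ℝ), ℝ⟯ →ₐ[ℝ] formAlgebra n X where
  toFun g := ofFunction g
  map_one' := Subtype.ext (funext fun _ => map_one (algebraMap ℝ _))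
  map_mul' g h := Subtype.ext (funext fun x => map_mul (algebraMap ℝ _) (g x) (h x))
  map_zero' := Subtype.ext (funext fun _ => map_zero (algebraMap ℝ _))
  map_add' g h := Subtype.ext (funext fun x => map_add (algebraMap ℝ _) (g x) (h x))
  commutes' _ := rfl

theorem ofFunction_mem_even (g : C^∞⟮𝓡 n, X; 𝓘(ℝ, ℝ), ℝ⟯) : ofFunction g ∈ (forms n X).even :=
  fun _ => algebraMap_mem (CliffordAlgebra.even (0 : QuadraticForm ℝ _)) _

theorem differential_mem_odd (g : C^∞⟮𝓡 n, X; 𝓘(ℝ, ℝ), ℝ⟯) : differential g ∈ (forms n X).odd :=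
  fun _ => CliffordAlgebra.ι_mem_evenOdd_one (0 : QuadraticForm ℝ _) _

end Manifold

namespace DualFrame

variable {n : ℕ} {X : Type u} [TopologicalSpace X] [ChartedSpace (EuclideanSpace ℝ (Fin n)) X]
  [IsManifold (𝓡 n) ∞ X] {ι : Type} [Fintype ι] (Φ : DualFrame n X ι)

instance : Module.Finite ℝ (ExteriorAlgebra ℝ (ι → ℝ)) := finite_exteriorAlgebra _

variable (ι) in
/-- A basis of the exterior algebra of `ℝ^ι`. -/
def extBasis : Module.Basis (Fin (Module.finrank ℝ (ExteriorAlgebra ℝ (ι → ℝ)))) ℝ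
    (ExteriorAlgebra ℝ (ι → ℝ)) := Module.finBasis ℝ _

theorem coef_add (l : Module.Dual ℝ (ExteriorAlgebra ℝ (ι → ℝ))) (α β : formAlgebra n X) :
    Φ.coef l (α + β) = Φ.coef l α + Φ.coef l β :=
  ContMDiffMap.ext fun x => by
    change l (Φ.toExt x (α.1 x + β.1 x)) = l (Φ.toExt x (α.1 x)) + l (Φ.toExt x (β.1 x))
    rw [map_add, map_add]

theorem linear_apply_eq_sum {V : Type*} [AddCommGroup V] [Module ℝ V]
    (T : ExteriorAlgebra ℝ (ι → ℝ) →ₗ[ℝ] V) (w : ExteriorAlgebra ℝ (ι → ℝ)) :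
    T w = ∑ I, (extBasis ι).coord I w • T (extBasis ι I) := by
  conv_lhs => rw [← (extBasis ι).sum_repr w, map_sum]
  simp

variable {B : Type*} [Ring B] [Algebra ℝ B] (f₀ : C^∞⟮𝓡 n, X; 𝓘(ℝ, ℝ), ℝ⟯ →ₐ[ℝ] B)
  (lam : ExteriorAlgebra ℝ (ι → ℝ) →ₐ[ℝ] B)

/-- The value at a form `α = ∑ I, a_I e_I`, with coefficients in the frame, of the would-be
extension `∑ I, f₀(a_I) lam(e_I)` of `f₀` and `lam`. -/
def extend (α : formAlgebra n X) : B :=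
  ∑ I, f₀ (Φ.coef ((extBasis ι).coord I) α) * lam (extBasis ι I)

/-- The extension can be computed from any expression `∑ k, g k • w k` of the form in the frame,
not only from the one in the chosen basis. -/
theorem extend_eq_sum {κ : Type*} [Fintype κ] {α : formAlgebra n X}
    (g : κ → C^∞⟮𝓡 n, X; 𝓘(ℝ, ℝ), ℝ⟯) (w : κ → ExteriorAlgebra ℝ (ι → ℝ))
    (h : ∀ x, Φ.toExt x (α.1 x) = ∑ k, g k x • w k) :
    Φ.extend f₀ lam α = ∑ k, f₀ (g k) * lam (w k) := by
  have hc (I) : Φ.coef ((extBasis ι).coord I) α = ∑ k, (extBasis ι).coord I (w k) • g k :=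
    ContMDiffMap.ext fun x => by
      change (extBasis ι).coord I (Φ.toExt x (α.1 x)) = _
      rw [h, map_sum, ← evalPoint_apply, map_sum]
      refine Finset.sum_congr rfl fun k _ => ?_
      rw [map_smul, map_smul, smul_eq_mul, smul_eq_mul, mul_comm]
      rfl
  have hl (k) := linear_apply_eq_sum lam.toLinearMap (w k)
  simp only [AlgHom.toLinearMap_apply] at hl
  simp only [extend, hc, hl, map_sum, map_smul, Finset.sum_mul, Finset.mul_sum, smul_mul_assoc,
    mul_smul_comm]
  rw [Finset.sum_comm]

theorem extend_ofFunction (g : C^∞⟮𝓡 n, X; 𝓘(ℝ, ℝ), ℝ⟯) :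
    Φ.extend f₀ lam (ofFunctionHom n X g) = f₀ g := by
  rw [Φ.extend_eq_sum f₀ lam (κ := Unit) (fun _ => g) (fun _ => 1) fun x => ?_]
  · simp
  · change Φ.toExt x (algebraMap ℝ _ (g x)) = _
    rw [AlgHom.commutes, Algebra.algebraMap_eq_smul_one]
    simp

theorem extend_differential [DecidableEq ι] (g : C^∞⟮𝓡 n, X; 𝓘(ℝ, ℝ), ℝ⟯) :
    Φ.extend f₀ lam (differential g : formAlgebra n X) =
      ∑ j, f₀ (Φ.fieldDeriv j g) * lam (ExteriorAlgebra.ι ℝ (Pi.single j 1)) := by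
  refine Φ.extend_eq_sum f₀ lam (fun j => Φ.fieldDeriv j g) _ fun x => ?_
  change Φ.toExt x (ExteriorAlgebra.ι ℝ _) = _
  rw [toExt_ι, pi_eq_sum_univ' (Φ.coordMap x _), map_sum]
  simp only [map_smul]
  rfl

/-- The extension as an algebra morphism, when the values of `f₀` are central. -/
def extendHom (hf₀ : ∀ g b, f₀ g * b = b * f₀ g) : formAlgebra n X →ₐ[ℝ] B :=
  AlgHom.ofLinearMap
    { toFun := Φ.extend f₀ lam
      map_add' α β := by
        simp only [extend, coef_add, map_add, add_mul, Finset.sum_add_distrib]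
      map_smul' r α := by
        rw [RingHom.id_apply, Φ.extend_eq_sum f₀ lam
          (fun I => r • Φ.coef ((extBasis ι).coord I) α) (extBasis ι) fun x => ?_]
        · simp only [extend, map_smul, smul_mul_assoc, Finset.smul_sum]
        · change Φ.toExt x (r • α.1 x) = _
          rw [map_smul]
          conv_lhs => rw [← (extBasis ι).sum_repr (Φ.toExt x (α.1 x)), Finset.smul_sum]
          simp only [smul_smul]
          rfl }
    (by
      have h := Φ.extend_ofFunction f₀ lam 1
      rwa [map_one, map_one] at h)
    (fun α β => by
      change Φ.extend f₀ lam (α * β) = Φ.extend f₀ lam α * Φ.extend f₀ lam β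
      rw [Φ.extend_eq_sum f₀ lam (κ := _ × _)
        (fun k => Φ.coef ((extBasis ι).coord k.1) α * Φ.coef ((extBasis ι).coord k.2) β)
        (fun k => extBasis ι k.1 * extBasis ι k.2) fun x => ?_]
      · rw [Fintype.sum_prod_type, extend, extend, Finset.sum_mul_sum]
        refine Finset.sum_congr rfl fun I _ => Finset.sum_congr rfl fun J _ => ?_
        rw [map_mul, map_mul, mul_assoc, mul_assoc, ← mul_assoc (f₀ (Φ.coef _ β)), hf₀ _ (lam _),
          mul_assoc]
      · change Φ.toExt x (α.1 x * β.1 x) = _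
        rw [map_mul]
        conv_lhs => rw [← (extBasis ι).sum_repr (Φ.toExt x (α.1 x)),
          ← (extBasis ι).sum_repr (Φ.toExt x (β.1 x)), Finset.sum_mul_sum]
        rw [Fintype.sum_prod_type]
        refine Finset.sum_congr rfl fun I _ => Finset.sum_congr rfl fun J _ => ?_
        rw [smul_mul_smul_comm]
        rfl)

/-- The projections `extPart` commute with `toExt`, so a form of parity `i` is a combination of
elements of `Λ ℝ^ι` of parity `i`. -/
theorem extend_mem {A : SuperAlg.{u}} (f₀ : C^∞⟮𝓡 n, X; 𝓘(ℝ, ℝ), ℝ⟯ →ₐ[ℝ] A)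
    (h₀ : ∀ g, f₀ g ∈ A.even) (θ : ι → A.odd) (i : ZMod 2) (α : formAlgebra n X)
    (hα : ∀ x, α.1 x ∈ CliffordAlgebra.evenOdd (0 : QuadraticForm ℝ _) i) :
    Φ.extend f₀ (oddLift θ) α ∈ A.grading i := by
  rw [Φ.extend_eq_sum f₀ (oddLift θ) (fun I => Φ.coef ((extBasis ι).coord I) α)
    (fun I => extPart _ i (extBasis ι I)) fun x => ?_]
  · refine sum_mem fun I _ => ?_
    have h := SetLike.mul_mem_graded (h₀ (Φ.coef ((extBasis ι).coord I) α))
      (oddLift_mem θ i (extPart_mem i (extBasis ι I)))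
    rwa [zero_add] at h
  · have h1 := map_extPart (Φ.coordMap x) i (α.1 x)
    rw [extPart_eq_self (hα x)] at h1
    exact h1.trans (linear_apply_eq_sum (extPart _ i) _)

/-- The algebra morphism from `Λ ℝ^ι` to differential forms that sends the basis vectors of `ℝ^ι` to
the differentials of the functions of the frame. -/
def toForms : ExteriorAlgebra ℝ (ι → ℝ) →ₐ[ℝ] formAlgebra n X :=
  oddLift (A := forms n X) fun j => ⟨differential (Φ.fn j), differential_mem_odd _⟩

theorem toForms_ι_single [DecidableEq ι] (j : ι) :
    Φ.toForms (ExteriorAlgebra.ι ℝ (Pi.single j 1)) = (differential (Φ.fn j) : formAlgebra n X) :=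
  oddLift_ι_single _ j

/-- Expressing a form in the frame and substituting `d(fn j)` for the basis vectors gives it back.
-/
theorem toForms_toExt (x : X) (a : FormsAt n x) :
    (Φ.toForms (Φ.toExt x a)).1 x = a := by
  classical
  let ev : formAlgebra n X →ₐ[ℝ] FormsAt n x :=
    (Pi.evalAlgHom ℝ (fun x : X => FormsAt n x) x).comp (formAlgebra n X).val
  suffices h : (ev.comp Φ.toForms).comp (Φ.toExt x) = AlgHom.id ℝ _ from DFunLike.congr_fun h a
  refine ExteriorAlgebra.hom_ext (LinearMap.ext fun φ => ?_)
  change ev (Φ.toForms (Φ.toExt x (ExteriorAlgebra.ι ℝ φ))) = ExteriorAlgebra.ι ℝ φ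
  rw [toExt_ι, pi_eq_sum_univ' (Φ.coordMap x φ)]
  simp only [map_sum, map_smul, toForms_ι_single]
  change ∑ j, φ (Φ.field j x) • ExteriorAlgebra.ι ℝ
    (mvfderiv (𝓡 n) (Φ.fn j) x : TangentSpace (𝓡 n) x →ₗ[ℝ] ℝ) = _
  simp only [← map_smul, ← map_sum]
  congr 1
  ext v
  conv_rhs => rw [← Φ.sum_smul_field x v, map_sum]
  simp [mul_comm]

/-- `Ω^*(X)` is generated by functions and the differentials of the functions of the frame. -/
theorem form_eq_sum (α : formAlgebra n X) :
    α = ∑ I, ofFunctionHom n X (Φ.coef ((extBasis ι).coord I) α) * Φ.toForms (extBasis ι I) := by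
  refine Subtype.ext (funext fun x => ?_)
  let ev : formAlgebra n X →ₐ[ℝ] FormsAt n x :=
    (Pi.evalAlgHom ℝ (fun x : X => FormsAt n x) x).comp (formAlgebra n X).val
  change α.1 x = ev _
  rw [map_sum]
  conv_lhs => rw [← Φ.toForms_toExt x (α.1 x)]
  change ev.toLinearMap.comp Φ.toForms.toLinearMap _ = _
  rw [linear_apply_eq_sum]
  refine Finset.sum_congr rfl fun I _ => ?_
  rw [map_mul]
  exact Algebra.smul_def _ _

theorem hom_ext (Φ : DualFrame n X ι) {B : Type*} [Ring B] [Algebra ℝ B]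
    {F G : formAlgebra n X →ₐ[ℝ] B}
    (h₀ : ∀ g, F (ofFunctionHom n X g) = G (ofFunctionHom n X g))
    (h₁ : ∀ g, F (differential g : formAlgebra n X) = G (differential g : formAlgebra n X)) :
    F = G := by
  classical
  have h : F.comp Φ.toForms = G.comp Φ.toForms := by
    refine ExteriorAlgebra.hom_ext (LinearMap.pi_ext' fun j => LinearMap.ext_ring ?_)
    change F (Φ.toForms (ExteriorAlgebra.ι ℝ (Pi.single j 1))) =
      G (Φ.toForms (ExteriorAlgebra.ι ℝ (Pi.single j 1)))
    rw [toForms_ι_single, h₁]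
  refine AlgHom.ext fun α => ?_
  rw [Φ.form_eq_sum α]
  simp only [map_sum, map_mul, h₀]
  refine Finset.sum_congr rfl fun I _ => ?_
  congr 1
  exact DFunLike.congr_fun h _

end DualFrame

/-! ### Sections as morphisms to `ℝ[θ] ⊗ A` -/

section Theta

variable {A T : SuperAlg.{u}}

theorem mul_odd_eq (x : T) {t : T} (ht : t ∈ T.odd) : x * t = t * T.parity x := by
  obtain ⟨a, ha, b, hb, rfl⟩ := exists_add x
  rw [map_add, parity_even ha, parity_odd hb, add_mul, mul_add, even_comm ha, odd_anticomm hb ht,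
    mul_neg]

/-- The morphism `ℝ[θ] ⊗ A ⟶ T`, `a + θ b ↦ α a + t (α b)`, given by an odd element `t` of `T` and a
morphism `α : A ⟶ T`. -/
def thetaDesc (t : T.odd) (α : A ⟶ T) : theta A ⟶ T where
  toAlgHom := AlgHom.ofLinearMap
    ((Hom.hom α).toLinearMap ∘ₗ ThetaExt.fst +
      LinearMap.mulLeft ℝ (t : T) ∘ₗ (Hom.hom α).toLinearMap ∘ₗ ThetaExt.snd : ThetaExt A →ₗ[ℝ] T)
    (by
      change Hom.hom α 1 + t * Hom.hom α 0 = 1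
      rw [map_one, map_zero, mul_zero, add_zero])
    (by
      intro (x : ThetaExt A) (y : ThetaExt A)
      change Hom.hom α (x.fst * y.fst) + t * Hom.hom α (x.snd * y.fst + A.parity x.fst * y.snd) =
        (Hom.hom α x.fst + t * Hom.hom α x.snd) * (Hom.hom α y.fst + t * Hom.hom α y.snd)
      simp only [map_add, map_mul, add_mul, mul_add, ← parity_hom]
      have h1 : Hom.hom α x.fst * (t * Hom.hom α y.snd) =
          t * (T.parity (Hom.hom α x.fst) * Hom.hom α y.snd) := by
        rw [← mul_assoc, mul_odd_eq _ t.2, mul_assoc]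
      have h2 : t * Hom.hom α x.snd * (t * Hom.hom α y.snd) = 0 := by
        rw [mul_assoc, ← mul_assoc (Hom.hom α x.snd), mul_odd_eq _ t.2, mul_assoc, ← mul_assoc,
          odd_mul_self t.2, zero_mul]
      rw [h1, h2, add_zero, mul_assoc, add_assoc])
  map_mem i x hx := by
    change Hom.hom α (ThetaExt.fst x) + t * Hom.hom α (ThetaExt.snd x) ∈ T.grading i
    refine add_mem (Hom.map_mem α _ _ hx.1) ?_
    have h := SetLike.mul_mem_graded t.2 (Hom.map_mem α _ _ hx.2)
    have e : (1 : ZMod 2) + (i + 1) = i := by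
      rw [add_comm i, ← add_assoc, one_add_one_zmod_two, zero_add]
    rwa [e] at h

theorem superHom_ext {f g : A ⟶ T} (h : ∀ a, Hom.hom f a = Hom.hom g a) : f = g :=
  SuperAlg.Hom.ext (AlgHom.ext h)

theorem thetaIncl_thetaDesc (t : T.odd) (α : A ⟶ T) : thetaIncl A ≫ thetaDesc t α = α :=
  superHom_ext fun a => by
    change Hom.hom α a + t * Hom.hom α 0 = Hom.hom α a
    rw [map_zero, mul_zero, add_zero]

theorem thetaDesc_thetaVar (t : T.odd) (α : A ⟶ T) :
    Hom.hom (thetaDesc t α) (thetaVar A).1 = t := by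
  change Hom.hom α 0 + t * Hom.hom α 1 = t
  rw [map_zero, zero_add, map_one, mul_one]

theorem thetaDesc_universal : thetaDesc (thetaVar A) (thetaIncl A) = 𝟙 (theta A) :=
  superHom_ext fun x => by
    let x' : ThetaExt A := x
    change ThetaExt.mk x'.fst 0 + ThetaExt.mk 0 1 * ThetaExt.mk x'.snd 0 = x'
    refine ThetaExt.ext ?_ ?_
    · rw [map_add, ThetaExt.fst_mul]; simp
    · rw [map_add, ThetaExt.snd_mul]; simp

theorem thetaDesc_comp {T' : SuperAlg.{u}} (t : T.odd) (α : A ⟶ T) (g : T ⟶ T') :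
    thetaDesc t α ≫ g = thetaDesc (affineOdd.map g t) (α ≫ g) :=
  superHom_ext fun x => by
    let x' : ThetaExt A := x
    change Hom.hom g (Hom.hom α x'.fst + t * Hom.hom α x'.snd) =
      Hom.hom g (Hom.hom α x'.fst) + Hom.hom g t * Hom.hom g (Hom.hom α x'.snd)
    rw [map_add, map_mul]

end Theta

section Sections

variable {n : ℕ} {X : Type u} [TopologicalSpace X] [ChartedSpace (EuclideanSpace ℝ (Fin n)) X]
  {A : SuperAlg.{u}}

/-- The section over `Spec A` given by a morphism `f : C^∞(X) ⟶ ℝ[θ] ⊗ A`: its `X`-component at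
`(t, α)` is the composite of `f` with the morphism `ℝ[θ] ⊗ A ⟶ T` given by `(t, α)`. -/
def sectionOf (f : smoothFunctions n X ⟶ theta A) : SectionsAt (projection n X) A where
  val :=
    { app T := ↾fun p => ((f ≫ thetaDesc p.1 p.2, p.1), p.2)
      naturality T T' g := by
        ext p
        refine Prod.ext (Prod.ext ?_ rfl) rfl
        exact congrArg (fun q => f ≫ q) (thetaDesc_comp p.1 p.2 g).symm }
  property := rfl

theorem universalValue_sectionOf (f : smoothFunctions n X ⟶ theta A) :
    universalValue (sectionOf f) = f := by
  change f ≫ thetaDesc (thetaVar A) (thetaIncl A) = f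
  rw [thetaDesc_universal, Category.comp_id]

/-- A section is determined by its value at the universal point, because every point `(t, α)` is the
image of the universal point by `thetaDesc t α`. -/
theorem sectionOf_universalValue (s : SectionsAt (projection n X) A) :
    sectionOf (universalValue s) = s := by
  refine Subtype.ext ?_
  ext T p
  obtain ⟨t, α⟩ := p
  have hn := NatTrans.naturality_apply s.1 (thetaDesc t α)
    (pair (F := affineOdd) (G := Spec A) (thetaVar A) (thetaIncl A))
  have hp : (prod affineOdd (Spec A)).map (thetaDesc t α)
      (pair (F := affineOdd) (G := Spec A) (thetaVar A) (thetaIncl A)) = (t, α) :=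
    Prod.ext (Subtype.ext (thetaDesc_thetaVar t α)) (thetaIncl_thetaDesc t α)
  rw [hp] at hn
  refine Prod.ext (Prod.ext ?_ ?_) ?_
  · exact (congrArg (fun q => q.1.1) hn).symm
  · exact (s.app_fst T t α).symm
  · exact (s.app_snd T (t, α)).symm

theorem universalValue_baseChange {B : SuperAlg.{u}} (φ : A ⟶ B)
    (s : SectionsAt (projection n X) A) :
    universalValue (SectionsAt.baseChange φ s) = (mappingSpace n X).map φ (universalValue s) := by
  have hn := NatTrans.naturality_apply s.1 (thetaMap φ)
    (pair (F := affineOdd) (G := Spec A) (thetaVar A) (thetaIncl A))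
  have hp : (prod affineOdd (Spec A)).map (thetaMap φ)
      (pair (F := affineOdd) (G := Spec A) (thetaVar A) (thetaIncl A)) =
      pair (F := affineOdd) (G := Spec A) (thetaVar B)
        ((specMap φ).app (theta B) (thetaIncl B)) := by
    refine Prod.ext (Subtype.ext (ThetaExt.ext ?_ ?_)) (superHom_ext fun a =>
      ThetaExt.ext rfl ?_)
    · exact map_zero (Hom.hom φ)
    · exact map_one (Hom.hom φ)
    · exact map_zero (Hom.hom φ)
  rw [hp] at hn
  exact congrArg (fun q => q.1.1) hn

variable (n X) in
/-- Sections over `Spec A` correspond to morphisms `C^∞(X) ⟶ ℝ[θ] ⊗ A`, naturally in `A`. -/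
def sectionIso : sectionSpace (projection n X) ≅ mappingSpace n X ⋙ uliftFunctor.{u + 1} :=
  NatIso.ofComponents (fun A => Equiv.toIso
    { toFun s := ULift.up (universalValue s)
      invFun f := sectionOf f.down
      left_inv s := sectionOf_universalValue s
      right_inv f := congrArg ULift.up (universalValue_sectionOf f.down) })
    (fun φ => by
      ext s
      exact congrArg ULift.up (universalValue_baseChange φ s))

end Sections

/-! ### Representability by differential forms -/

/-- The algebra morphism `F ∘ o + θ (F ∘ d) : R → ℝ[θ] ⊗ A`, for algebra morphisms `o : R → S` and
`F : S → A` such that `F ∘ o` has even values, and a derivation `d` over `o`. -/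
def thetaPair {R S : Type*} [CommRing R] [Algebra ℝ R] [Ring S] [Algebra ℝ S] {A : SuperAlg.{u}}
    (o : R →ₐ[ℝ] S) (d : R →ₗ[ℝ] S) (hd : ∀ g h, d (g * h) = d g * o h + o g * d h)
    (F : S →ₐ[ℝ] A) (hF : ∀ g, F (o g) ∈ A.even) : R →ₐ[ℝ] ThetaExt A :=
  AlgHom.ofLinearMap
    (LinearMap.prod (F.toLinearMap ∘ₗ o.toLinearMap) (F.toLinearMap ∘ₗ d) : R →ₗ[ℝ] ThetaExt A)
    (ThetaExt.ext
      (by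
        change F (o 1) = 1
        rw [map_one, map_one])
      (by
        change F (d 1) = 0
        have h := hd 1 1
        rw [map_one o, mul_one, mul_one, one_mul] at h
        rw [left_eq_add.1 h, map_zero]))
    (fun g h => ThetaExt.ext
      (by
        change F (o (g * h)) = F (o g) * F (o h)
        rw [map_mul, map_mul])
      (by
        change F (d (g * h)) = F (d g) * F (o h) + A.parity (F (o g)) * F (d h)
        rw [parity_even (hF g), hd, map_add, map_mul, map_mul]))

section Manifold

variable {n : ℕ} {X : Type u} [TopologicalSpace X] [ChartedSpace (EuclideanSpace ℝ (Fin n)) X]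
  {A : SuperAlg.{u}}

/-- The component `f₀` of `f = f₀ + θ f₁ : C^∞(X) ⟶ ℝ[θ] ⊗ A`, as an algebra morphism. -/
def comp0Hom (f : smoothFunctions n X ⟶ theta A) : C^∞⟮𝓡 n, X; 𝓘(ℝ, ℝ), ℝ⟯ →ₐ[ℝ] A :=
  AlgHom.ofLinearMap (ThetaExt.fst ∘ₗ
      (show C^∞⟮𝓡 n, X; 𝓘(ℝ, ℝ), ℝ⟯ →ₐ[ℝ] ThetaExt A from Hom.hom f).toLinearMap)
    (congrArg ThetaExt.fst (map_one (Hom.hom f)))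
    (fun g h => congrArg ThetaExt.fst (map_mul (Hom.hom f) g h))

/-- The component `f₁` of `f = f₀ + θ f₁ : C^∞(X) ⟶ ℝ[θ] ⊗ A`, as a linear map. -/
def comp1Lin (f : smoothFunctions n X ⟶ theta A) : C^∞⟮𝓡 n, X; 𝓘(ℝ, ℝ), ℝ⟯ →ₗ[ℝ] A :=
  ThetaExt.snd ∘ₗ
    (show C^∞⟮𝓡 n, X; 𝓘(ℝ, ℝ), ℝ⟯ →ₐ[ℝ] ThetaExt A from Hom.hom f).toLinearMap

theorem mem_even_smoothFunctions (g : smoothFunctions n X) : g ∈ (smoothFunctions n X).even := by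
  change g ∈ (if (0 : ZMod 2) = 0 then ⊤ else ⊥ : Submodule ℝ C^∞⟮𝓡 n, X; 𝓘(ℝ, ℝ), ℝ⟯)
  rw [if_pos rfl]
  trivial

/-- An algebra morphism `C^∞(X) → T` with even values, as a morphism of superalgebras. -/
def homOfEven {T : SuperAlg.{u}} (φ : C^∞⟮𝓡 n, X; 𝓘(ℝ, ℝ), ℝ⟯ →ₐ[ℝ] T) (hφ : ∀ g, φ g ∈ T.even) :
    smoothFunctions n X ⟶ T where
  toAlgHom := φ
  map_mem i g hg := by
    rcases zmod_two_cases i with rfl | rfl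
    · exact hφ g
    · have h0 : g = 0 := by
        change g ∈ (if (1 : ZMod 2) = 0 then ⊤ else ⊥ : Submodule ℝ C^∞⟮𝓡 n, X; 𝓘(ℝ, ℝ), ℝ⟯) at hg
        rw [if_neg one_ne_zero] at hg
        exact (Submodule.mem_bot ℝ).1 hg
      rw [h0]
      exact (map_zero φ).symm ▸ zero_mem _

theorem comp0Hom_mem (f : smoothFunctions n X ⟶ theta A) (g) : comp0Hom f g ∈ A.even :=
  (Hom.map_mem f 0 g (mem_even_smoothFunctions g)).1

theorem comp1Lin_mem (f : smoothFunctions n X ⟶ theta A) (g) : comp1Lin f g ∈ A.odd :=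
  (Hom.map_mem f 0 g (mem_even_smoothFunctions g)).2

theorem comp1Lin_mul (f : smoothFunctions n X ⟶ theta A) (g h) :
    comp1Lin f (g * h) = comp1Lin f g * comp0Hom f h + comp0Hom f g * comp1Lin f h := by
  have h1 : comp1Lin f (g * h) =
      comp1Lin f g * comp0Hom f h + A.parity (comp0Hom f g) * comp1Lin f h :=
    congrArg ThetaExt.snd (map_mul (Hom.hom f) g h)
  rw [h1, parity_even (comp0Hom_mem f g)]

variable [IsManifold (𝓡 n) ∞ X]

/-- The derivation `f₁` over `f₀` satisfies `f₁(g) = ∑ j, f₀(Y_j g) f₁(h_j)` in a frame. -/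
theorem comp1Lin_eq_sum [T2Space X] [SecondCountableTopology X] (hA : IsSCG A) {ι : Type}
    [Fintype ι] (Φ : DualFrame n X ι) (f : smoothFunctions n X ⟶ theta A)
    (g : C^∞⟮𝓡 n, X; 𝓘(ℝ, ℝ), ℝ⟯) :
    comp1Lin f g = ∑ j, comp0Hom f (Φ.fieldDeriv j g) * comp1Lin f (Φ.fn j) := by
  refine odd_derivation_eq_sum hA (comp0Hom f) (comp0Hom_mem f) (comp1Lin f) (comp1Lin_mem f)
    (comp1Lin_mul f) Φ.fn Φ.fieldDeriv Φ.fieldDeriv_eq_sum (fun χ => ?_) (fun χ g => ?_) g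
  · obtain ⟨p, rfl⟩ := exists_eq_evalPoint χ
    exact pointIdeal_fg p
  · obtain ⟨p, rfl⟩ := exists_eq_evalPoint χ
    exact Φ.sub_linear_mem_pointIdeal_sq p g

/-- The morphism `F : Ω^*(X) ⟶ A` with `F(g) = f₀(g)` for all functions `g` and
`F(dg) = ∑ j, f₀(Y_j g) f₁(h_j)`, for `f = f₀ + θ f₁ : C^∞(X) ⟶ ℝ[θ] ⊗ A`. This sum is `f₁(g)`
when `A` is smoothly closed geometric. -/
def formsHom {ι : Type} [Fintype ι] (Φ : DualFrame n X ι) (f : smoothFunctions n X ⟶ theta A) :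
    forms n X ⟶ A where
  toAlgHom := Φ.extendHom (comp0Hom f) (oddLift fun j => ⟨comp1Lin f (Φ.fn j), comp1Lin_mem f _⟩)
    (fun g b => even_comm (comp0Hom_mem f g) b)
  map_mem i α hα := Φ.extend_mem (comp0Hom f) (comp0Hom_mem f) _ i α hα

theorem formsHom_ofFunction {ι : Type} [Fintype ι] (Φ : DualFrame n X ι)
    (f : smoothFunctions n X ⟶ theta A) (g : C^∞⟮𝓡 n, X; 𝓘(ℝ, ℝ), ℝ⟯) :
    Hom.hom (formsHom Φ f) (ofFunction g) = comp0Hom f g :=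
  Φ.extend_ofFunction _ _ g

theorem formsHom_differential [T2Space X] [SecondCountableTopology X] (hA : IsSCG A) {ι : Type}
    [Fintype ι] (Φ : DualFrame n X ι) (f : smoothFunctions n X ⟶ theta A)
    (g : C^∞⟮𝓡 n, X; 𝓘(ℝ, ℝ), ℝ⟯) :
    Hom.hom (formsHom Φ f) (differential g) = comp1Lin f g := by
  classical
  rw [comp1Lin_eq_sum hA Φ]
  refine (Φ.extend_differential _ _ g).trans (Finset.sum_congr rfl fun j _ => ?_)
  rw [oddLift_ι_single]

variable (n X) in
/-- The differential, as a linear map from smooth functions to forms. -/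
def differentialLin : C^∞⟮𝓡 n, X; 𝓘(ℝ, ℝ), ℝ⟯ →ₗ[ℝ] formAlgebra n X where
  toFun g := differential g
  map_add' g h := Subtype.ext (funext fun x => by
    refine (congrArg (ExteriorAlgebra.ι ℝ) ?_).trans (map_add (ExteriorAlgebra.ι ℝ) _ _)
    exact LinearMap.ext fun v => map_add (derivAlong x v) g h)
  map_smul' r g := Subtype.ext (funext fun x => by
    refine (congrArg (ExteriorAlgebra.ι ℝ) ?_).trans (map_smul (ExteriorAlgebra.ι ℝ) r _)
    exact LinearMap.ext fun v => map_smul (derivAlong x v) r g)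

theorem differentialLin_mul (g h : C^∞⟮𝓡 n, X; 𝓘(ℝ, ℝ), ℝ⟯) :
    differentialLin n X (g * h) = differentialLin n X g * ofFunctionHom n X h +
      ofFunctionHom n X g * differentialLin n X h := by
  refine Subtype.ext (funext fun x => ?_)
  have e : (mvfderiv (𝓡 n) (g * h : C^∞⟮𝓡 n, X; 𝓘(ℝ, ℝ), ℝ⟯) x : TangentSpace (𝓡 n) x →ₗ[ℝ] ℝ) =
      h x • (mvfderiv (𝓡 n) g x : TangentSpace (𝓡 n) x →ₗ[ℝ] ℝ) +
      g x • (mvfderiv (𝓡 n) h x : TangentSpace (𝓡 n) x →ₗ[ℝ] ℝ) :=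
    LinearMap.ext fun v => (derivAlong_mul x v g h).trans (add_comm _ _)
  refine (congrArg (ExteriorAlgebra.ι ℝ) e).trans ((map_add (ExteriorAlgebra.ι ℝ) _ _).trans ?_)
  refine congrArg₂ (· + ·) ?_ ?_
  · exact ((map_smul (ExteriorAlgebra.ι ℝ) (h x) _).trans
      (Algebra.smul_def (A := FormsAt n x) (h x) _)).trans
      (Algebra.commutes (A := FormsAt n x) (h x) _)
  · exact (map_smul (ExteriorAlgebra.ι ℝ) (g x) _).trans
      (Algebra.smul_def (A := FormsAt n x) (g x) _)

/-- The morphism `f₀ + θ f₁ : C^∞(X) ⟶ ℝ[θ] ⊗ A` with `f₀(g) = F(g)` and `f₁(g) = F(dg)`, for a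
morphism `F : Ω^*(X) ⟶ A`. -/
def pointOfForms (F : forms n X ⟶ A) : smoothFunctions n X ⟶ theta A :=
  homOfEven
    (thetaPair (S := formAlgebra n X) (ofFunctionHom n X) (differentialLin n X) differentialLin_mul
      (Hom.hom F) fun g => Hom.map_mem F 0 (ofFunction g) (ofFunction_mem_even g))
    fun g => ⟨Hom.map_mem F 0 (ofFunction g) (ofFunction_mem_even g),
      Hom.map_mem F 1 (differential g) (differential_mem_odd g)⟩

theorem forms_hom_ext [T2Space X] [SecondCountableTopology X] {F G : forms n X ⟶ A}
    (h₀ : ∀ g : C^∞⟮𝓡 n, X; 𝓘(ℝ, ℝ), ℝ⟯, Hom.hom F (ofFunction g) = Hom.hom G (ofFunction g))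
    (h₁ : ∀ g : C^∞⟮𝓡 n, X; 𝓘(ℝ, ℝ), ℝ⟯, Hom.hom F (differential g) = Hom.hom G (differential g)) :
    F = G := by
  obtain ⟨Φ⟩ := exists_dualFrame n X
  exact SuperAlg.Hom.ext (Φ.hom_ext (F := Hom.hom F) (G := Hom.hom G) h₀ h₁)

theorem comp0Hom_pointOfForms (F : forms n X ⟶ A) (g : C^∞⟮𝓡 n, X; 𝓘(ℝ, ℝ), ℝ⟯) :
    comp0Hom (pointOfForms F) g = Hom.hom F (ofFunction g) := rfl

theorem comp1Lin_pointOfForms (F : forms n X ⟶ A) (g : C^∞⟮𝓡 n, X; 𝓘(ℝ, ℝ), ℝ⟯) :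
    comp1Lin (pointOfForms F) g = Hom.hom F (differential g) := rfl

theorem pointOfForms_formsHom [T2Space X] [SecondCountableTopology X] (hA : IsSCG A) {ι : Type}
    [Fintype ι] (Φ : DualFrame n X ι) (f : smoothFunctions n X ⟶ theta A) :
    pointOfForms (formsHom Φ f) = f :=
  superHom_ext fun g => ThetaExt.ext
    ((comp0Hom_pointOfForms _ g).trans (formsHom_ofFunction Φ f g))
    ((comp1Lin_pointOfForms _ g).trans (formsHom_differential hA Φ f g))

theorem formsHom_pointOfForms [T2Space X] [SecondCountableTopology X] (hA : IsSCG A) {ι : Type}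
    [Fintype ι] (Φ : DualFrame n X ι) (F : forms n X ⟶ A) : formsHom Φ (pointOfForms F) = F :=
  forms_hom_ext
    (fun g => (formsHom_ofFunction Φ _ g).trans (comp0Hom_pointOfForms F g))
    (fun g => (formsHom_differential hA Φ _ g).trans (comp1Lin_pointOfForms F g))

/-- On smoothly closed geometric superalgebras, `Hom(ℝ^{0|1}, X)` is represented by `Ω^*(X)`. -/
def mappingSpaceIso [T2Space X] [SecondCountableTopology X] {ι : Type} [Fintype ι]
    (Φ : DualFrame n X ι) :
    incl.{u} ⋙ mappingSpace n X ≅ incl.{u} ⋙ Spec (forms n X) :=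
  NatIso.ofComponents (fun A => Equiv.toIso
    { toFun f := formsHom Φ (A := A.obj) f
      invFun F := pointOfForms (A := A.obj) F
      left_inv f := pointOfForms_formsHom A.property Φ f
      right_inv F := formsHom_pointOfForms A.property Φ F })
    (fun {A B} φ => by
      ext f
      refine forms_hom_ext (A := B.obj) (fun g => ?_) (fun g => ?_)
      · exact (formsHom_ofFunction Φ _ g).trans
          (congrArg (Hom.hom (incl.map φ)) (formsHom_ofFunction Φ (A := A.obj) f g)).symm
      · exact (formsHom_differential B.property Φ _ g).trans
          (congrArg (Hom.hom (incl.map φ))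
            (formsHom_differential A.property Φ (A := A.obj) f g)).symm)

end Manifold

/-! ### The superalgebra of differential forms is smoothly closed geometric -/

theorem IsSmoothlyClosedGeometric.of_algEquiv {B C : Type u} [CommRing B] [Algebra ℝ B] [CommRing C]
    [Algebra ℝ C] (e : B ≃ₐ[ℝ] C) (hC : IsSmoothlyClosedGeometric C) :
    IsSmoothlyClosedGeometric B := by
  intro k a f hf
  obtain ⟨c, hc, huniq⟩ := hC k (fun i => e (a i)) f hf
  refine ⟨e.symm c, fun x => ?_, fun b hb => ?_⟩
  · have h := hc (x.comp e.symm.toAlgHom)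
    simpa using h
  · refine e.injective ((huniq (e b) fun x => ?_).trans (e.apply_symm_apply c).symm)
    exact hb (x.comp e.toAlgHom)

section Splitting

variable {A : SuperAlg.{u}}

/-- The module structure of the odd part over the heart given by a splitting of `A → |A|`. -/
@[reducible] def oddModule (σ : Heart A →ₐ[ℝ] A) (hσ : ∀ b, σ b ∈ A.even) :
    Module (Heart A) A.odd where
  smul b m := ⟨σ b * m, even_mul_odd (hσ b) m.2⟩
  one_smul m := Subtype.ext (by
    change σ 1 * m = (m : A)
    rw [map_one, one_mul])
  mul_smul b c m := Subtype.ext (by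
    change σ (b * c) * m = σ b * (σ c * m)
    rw [map_mul, mul_assoc])
  smul_zero b := Subtype.ext (mul_zero (σ b))
  smul_add b m m' := Subtype.ext (mul_add (σ b) m m')
  add_smul b c m := Subtype.ext (by
    change σ (b + c) * m = σ b * m + σ c * m
    rw [map_add, add_mul])
  zero_smul m := Subtype.ext (by
    change σ 0 * m = (0 : A)
    rw [map_zero, zero_mul])

end Splitting

section Manifold

variable {n : ℕ} {X : Type u} [TopologicalSpace X] [ChartedSpace (EuclideanSpace ℝ (Fin n)) X]

theorem isSmoothlyClosedGeometric_smoothFunctions [T2Space X] [SecondCountableTopology X]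
    [IsManifold (𝓡 n) ∞ X] : IsSmoothlyClosedGeometric C^∞⟮𝓡 n, X; 𝓘(ℝ, ℝ), ℝ⟯ := by
  intro k a f hf
  have ha : ContMDiff (𝓡 n) 𝓘(ℝ, Fin k → ℝ) ∞ fun p i => a i p :=
    contMDiff_pi_space.2 fun i => (a i).contMDiff
  refine ⟨⟨fun p => f fun i => a i p, hf.contMDiff.comp ha⟩, fun x => ?_, fun b hb => ?_⟩
  · obtain ⟨p, rfl⟩ := exists_eq_evalPoint x
    rfl
  · exact ContMDiffMap.ext fun p => (hb (evalPoint p)).symm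

namespace DualFrame

variable [IsManifold (𝓡 n) ∞ X] {ι : Type} [Fintype ι] (Φ : DualFrame n X ι)

/-- The component of degree `0` of a form. -/
def scalarPart : formAlgebra n X →ₐ[ℝ] C^∞⟮𝓡 n, X; 𝓘(ℝ, ℝ), ℝ⟯ where
  toFun α := Φ.coef ExteriorAlgebra.algebraMapInv.toLinearMap α
  map_one' := ContMDiffMap.ext fun x => by
    change ExteriorAlgebra.algebraMapInv (Φ.toExt x 1) = 1
    rw [map_one, map_one]
  map_mul' α β := ContMDiffMap.ext fun x => by
    change ExteriorAlgebra.algebraMapInv (Φ.toExt x (α.1 x * β.1 x)) =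
      ExteriorAlgebra.algebraMapInv (Φ.toExt x (α.1 x)) *
        ExteriorAlgebra.algebraMapInv (Φ.toExt x (β.1 x))
    rw [map_mul, map_mul]
  map_zero' := ContMDiffMap.ext fun x => by
    change ExteriorAlgebra.algebraMapInv (Φ.toExt x 0) = 0
    rw [map_zero, map_zero]
  map_add' α β := Φ.coef_add _ α β
  commutes' r := ContMDiffMap.ext fun x => by
    change ExteriorAlgebra.algebraMapInv (Φ.toExt x (algebraMap ℝ (FormsAt n x) r)) = r
    rw [AlgHom.commutes, AlgHom.commutes, Algebra.algebraMap_self_apply]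

theorem scalarPart_ofFunction (g : C^∞⟮𝓡 n, X; 𝓘(ℝ, ℝ), ℝ⟯) :
    Φ.scalarPart (ofFunctionHom n X g) = g :=
  ContMDiffMap.ext fun x => by
    change ExteriorAlgebra.algebraMapInv (Φ.toExt x (algebraMap ℝ (FormsAt n x) (g x))) = g x
    rw [AlgHom.commutes, AlgHom.commutes, Algebra.algebraMap_self_apply]

/-- Odd elements have square zero, and `C^∞(X)` has no nilpotent elements. -/
theorem scalarPart_eq_zero {α : formAlgebra n X} (hα : α ∈ (forms n X).odd) :
    Φ.scalarPart α = 0 :=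
  ContMDiffMap.ext fun x => by
    have h : α * α = 0 := odd_mul_self hα
    have h' := congrArg (fun β => evalPoint x (Φ.scalarPart β)) h
    simp only [map_mul, map_zero] at h'
    exact mul_self_eq_zero.1 h'

/-- The heart of `Ω^*(X)` is the algebra of smooth functions. -/
def heartEquiv : Heart (forms n X) ≃ₐ[ℝ] C^∞⟮𝓡 n, X; 𝓘(ℝ, ℝ), ℝ⟯ :=
  let τ : Heart (forms n X) →ₐ[ℝ] C^∞⟮𝓡 n, X; 𝓘(ℝ, ℝ), ℝ⟯ :=
    Ideal.Quotient.liftₐ (oddIdeal (forms n X)) Φ.scalarPart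
      (fun α hα => (Ideal.span_le (I := RingHom.ker Φ.scalarPart)).2
        (fun _ h => Φ.scalarPart_eq_zero h) hα)
  let q : formAlgebra n X →ₐ[ℝ] Heart (forms n X) := Ideal.Quotient.mkₐ ℝ (oddIdeal (forms n X))
  AlgEquiv.ofAlgHom τ (q.comp (ofFunctionHom n X))
    (AlgHom.ext Φ.scalarPart_ofFunction)
    (by
      have h : (q.comp (ofFunctionHom n X)).comp Φ.scalarPart = q := by
        refine Φ.hom_ext (fun g => ?_) (fun g => ?_)
        · exact congrArg (fun h => q (ofFunctionHom n X h)) (Φ.scalarPart_ofFunction g)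
        · have h0 : q (differential g) = 0 :=
            Ideal.Quotient.eq_zero_iff_mem (I := oddIdeal (forms n X)).2
              (Ideal.subset_span (differential_mem_odd g))
          rw [h0]
          change q (ofFunctionHom n X (Φ.scalarPart _)) = 0
          rw [Φ.scalarPart_eq_zero (differential_mem_odd g), map_zero, map_zero]
      refine AlgHom.ext fun b => ?_
      obtain ⟨α, rfl⟩ := Ideal.Quotient.mk_surjective b
      exact DFunLike.congr_fun h α)

end DualFrame

variable (n X) in
/-- `Ω^*(X)` is smoothly closed geometric: functions are a splitting of the projection on the heart,
and a form that vanishes at each point of `X` is zero. -/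
theorem isSCG_forms [T2Space X] [SecondCountableTopology X] [IsManifold (𝓡 n) ∞ X] :
    IsSCG (forms n X) := by
  obtain ⟨Φ⟩ := exists_dualFrame n X
  let σ : Heart (forms n X) →ₐ[ℝ] forms n X :=
    (show C^∞⟮𝓡 n, X; 𝓘(ℝ, ℝ), ℝ⟯ →ₐ[ℝ] forms n X from ofFunctionHom n X).comp Φ.heartEquiv.toAlgHom
  have hσ (b) : σ b ∈ (forms n X).even := ofFunction_mem_even (Φ.heartEquiv b)
  let _ := oddModule σ hσ
  refine ⟨isSmoothlyClosedGeometric_smoothFunctions.of_algEquiv Φ.heartEquiv, oddModule σ hσ,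
    ⟨fun r b m => Subtype.ext ?_⟩,
    fun b => ⟨σ b, hσ b, Φ.heartEquiv.symm_apply_apply b, fun _ => rfl⟩,
    eq_bot_iff.2 fun m hm => ?_⟩
  · change σ (r • b) * m = r • (σ b * m)
    rw [map_smul, smul_mul_assoc]
  · refine (Submodule.mem_bot _).2 (Subtype.ext (Subtype.ext (funext fun x => ?_)))
    let χ : Heart (forms n X) →ₐ[ℝ] ℝ := (evalPoint x).comp Φ.heartEquiv.toAlgHom
    have h := (Submodule.mem_iInf _).1 hm χ
    refine Submodule.smul_induction_on h (p := fun m => (m.1 : formAlgebra n X).1 x = 0)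
      (fun b hb m _ => ?_) (fun m m' h h' => ?_)
    · have hb' : Φ.heartEquiv b x = 0 := hb
      change algebraMap ℝ (FormsAt n x) (Φ.heartEquiv b x) * (m.1 : formAlgebra n X).1 x = 0
      rw [hb', map_zero, zero_mul]
    · change (m.1 : formAlgebra n X).1 x + (m'.1 : formAlgebra n X).1 x = 0
      rw [h, h', add_zero]

end Manifold

/-! ### Functions on a representable functor -/

section Yoneda

variable {P : SCG.{u} ⥤ Type (u + 1)} (B : SCG.{u})
  (E : P ≅ incl.{u} ⋙ Spec B.obj ⋙ uliftFunctor.{u + 1})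

/-- The function `s ↦ E(s)(α)` on `P` given by an even element `α` of `B`, for an isomorphism `E`
of `P` with the functor represented by `B`. -/
def functionOf (α : B.obj.even) : P ⟶ incl.{u} ⋙ affineEven ⋙ uliftFunctor.{u + 1} where
  app A := ↾fun s => ULift.up ((affineEven.map (E.hom.app A s).down) α)
  naturality A A' φ := by
    ext s
    have h := congrArg ULift.down (NatTrans.naturality_apply E.hom φ s)
    exact congrArg (fun F : B.obj ⟶ A'.obj => ULift.up (affineEven.map F α)) h

/-- The universal point of the functor represented by `B`, as a point of `P`. -/
def universalPoint : P.obj B :=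
  E.inv.app B (show (incl.{u} ⋙ Spec B.obj ⋙ uliftFunctor.{u + 1}).obj B from ULift.up (𝟙 B.obj))

theorem map_universalPoint {A : SCG.{u}} (s : P.obj A) :
    P.map (ObjectProperty.homMk (E.hom.app A s).down) (universalPoint B E) = s := by
  refine (NatTrans.naturality_apply E.inv _ _).symm.trans (Eq.trans ?_
    (ConcreteCategory.congr_hom (E.hom_inv_id_app A) s))
  exact congrArg (E.inv.app A) (congrArg ULift.up (Category.id_comp (E.hom.app A s).down))

theorem hom_universalPoint : E.hom.app B (universalPoint B E) = ULift.up (𝟙 B.obj) :=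
  ConcreteCategory.congr_hom (E.inv_hom_id_app B) _

/-- The Yoneda lemma for functions with values in `𝔸^{1|0}`: if `P` is represented by `B` on
smoothly closed geometric superalgebras, then the functions on `P` are the even elements of `B`. -/
def functionsEquiv : B.obj.even ≃ (P ⟶ incl.{u} ⋙ affineEven ⋙ uliftFunctor.{u + 1}) where
  toFun α := functionOf B E α
  invFun η := (η.app B (universalPoint B E)).down
  left_inv α :=
    congrArg (fun F : ULift.{u + 1} (B.obj ⟶ B.obj) => affineEven.map F.down α)
      (hom_universalPoint B E)
  right_inv η := by
    refine NatTrans.ext (funext fun A => ConcreteCategory.hom_ext _ _ fun s => ?_)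
    have h := NatTrans.naturality_apply η (ObjectProperty.homMk (E.hom.app A s).down)
      (universalPoint B E)
    rw [map_universalPoint] at h
    exact h.symm

end Yoneda

end Super

end

theorem mainTheorem2 (n : ℕ) (X : Type u) [TopologicalSpace X] [T2Space X]
    [SecondCountableTopology X] [ChartedSpace (EuclideanSpace ℝ (Fin n)) X]
    [IsManifold (𝓡 n) ∞ X] :
    ∃ (e₁ : Super.SuperAlg.incl ⋙ Super.sectionSpace (Super.projection n X) ≅
          Super.SuperAlg.incl ⋙ Super.mappingSpace n X ⋙ uliftFunctor.{u + 1})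
      (e₂ : Super.SuperAlg.incl ⋙ Super.mappingSpace n X ≅
          Super.SuperAlg.incl ⋙ Super.Spec (Super.forms n X))
      (Φ : (Super.forms n X).even ≃
          (Super.SuperAlg.incl ⋙ Super.sectionSpace (Super.projection n X) ⟶
            Super.SuperAlg.incl ⋙ Super.affineEven ⋙ uliftFunctor.{u + 1})),
      (∀ (A : Super.SuperAlg.SCG.{u}) (s : Super.SectionsAt (Super.projection n X) A.obj),
        (e₁.hom.app A s).down = Super.universalValue s) ∧
      (∀ (A : Super.SuperAlg.SCG.{u}) (f : (Super.mappingSpace n X).obj A.obj)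
          (g : C^∞⟮𝓡 n, X; 𝓘(ℝ, ℝ), ℝ⟯),
        Super.evalForm (e₂.hom.app A f) (Super.ofFunction g) = Super.comp0 f g ∧
        Super.evalForm (e₂.hom.app A f) (Super.differential g) = Super.comp1 f g) ∧
      (∀ (α : (Super.forms n X).even) (A : Super.SuperAlg.SCG.{u})
          (s : Super.SectionsAt (Super.projection n X) A.obj),
        (((Φ α).app A s).down : A.obj.even).1 =
          Super.evalForm (e₂.hom.app A (e₁.hom.app A s).down) α.1) := by
  obtain ⟨Φ⟩ := Super.exists_dualFrame n X
  let e₁ := Functor.isoWhiskerLeft Super.SuperAlg.incl (Super.sectionIso n X)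
  let e₂ := Super.mappingSpaceIso Φ
  exact ⟨e₁, e₂, Super.functionsEquiv ⟨Super.forms n X, Super.isSCG_forms n X⟩
      (e₁ ≪≫ Functor.isoWhiskerRight e₂ uliftFunctor.{u + 1}),
    fun _ _ => rfl,
    fun A f g => ⟨Super.formsHom_ofFunction Φ (A := A.obj) f g,
      Super.formsHom_differential A.property Φ (A := A.obj) f g⟩,
    fun _ _ _ => rfl⟩
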